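/- Let $(M,g)$ be a smooth Riemannian manifold of dimension $n$ with Levi-Civita connection $\nabla$ and curvature tensor $R(X,Y)Z=\nabla_X\nabla_YZ-\nabla_Y\nabla_XZ-\nabla_{[X,Y]}Z$, let $p>0$, let $I\subset\mathbb{R}$ be an interval with more than one point, and let $\gamma\colon I\to M$ be a smooth curve with tension field $\tau(\gamma)=\nabla_{\gamma'}\gamma'$. If $p<2$, assume that $\tau(\gamma)$ has no zeros on $I$. Then the equation for $p$-biharmonic curves $$\nabla_{\gamma'}\nabla_{\gamma'}\big(|\nabla_{\gamma'}\gamma'|^{p-2}\nabla_{\gamma'}\gamma'\big)-|\nabla_{\gamma'}\gamma'|^{p-2}R(\gamma',\nabla_{\gamma'}\gamma')\gamma'=0$$ on $I$ is equivalent to the requirement that, in every smooth chart of $M$ and at every parameter $s\in I$ for which $\gamma(s)$ lies in the domain of the chart, the system of Euler-Lagrange equations $$\frac{d^2}{ds^2}\Big(\frac{\partial\mathcal{L}_{2,p}}{\partial\gamma''^k}\Big)-\frac{d}{ds}\Big(\frac{\partial\mathcal{L}_{2,p}}{\partial\gamma'^k}\Big)+\frac{\partial\mathcal{L}_{2,p}}{\partial\gamma^k}=0,\qquad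 k=1,\dots,n,$$ holds. Here $\mathcal{L}_{2,p}=|\tau(\gamma)|^p=g(\tau(\gamma),\tau(\gamma))^{p/2}$ is regarded as a function of the coordinates $(\gamma^k)$, $(\gamma'^k)$, $(\gamma''^k)$ through $\tau(\gamma)^k=\gamma''^k+\Gamma^k_{ij}(\gamma)\gamma'^i\gamma'^j$. Moreover, the equivalence holds pointwise in every single chart: if $\gamma(s)$ lies in the domain of a chart, then the first equation holds at $s$ if and only if the system holds at $s$ in that chart. Here each of the two equations is understood to hold at $s$ only if the derivatives with respect to the curve parameter occurring in it exist there. -/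

import Mathlib

open scoped Manifold ContDiff Topology

noncomputable section

namespace PBiharmonic

/-- `n`-dimensional coordinate space, the model space of the manifolds considered here. -/
abbrev Coord (n : ℕ) : Type := EuclideanSpace ℝ (Fin n)

/-- The `k`-th coordinate vector of `ℝⁿ`. -/
def stdVec {n : ℕ} (k : Fin n) : Coord n := EuclideanSpace.single k 1

/-- The partial derivative `∂f/∂xᵏ` at `x`. -/
def pd {n : ℕ} (k : Fin n) (f : Coord n → ℝ) (x : Coord n) : ℝ := fderiv ℝ f x (stdVec k)

/-! ### Local formulas for a metric `G = (G_{ij})` given in coordinates -/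

section Local

variable {n : ℕ} (G : Coord n → Matrix (Fin n) (Fin n) ℝ)

/-- Christoffel symbols of the Levi-Civita connection,
`Γᵏ_{ij} = ½ ∑ₗ Gᵏˡ (∂ᵢ G_{jl} + ∂ⱼ G_{il} - ∂ₗ G_{ij})`. -/
def christoffel (x : Coord n) (k i j : Fin n) : ℝ :=
  (1 / 2) * ∑ l, (G x)⁻¹ k l *
    (pd i (fun y => G y j l) x + pd j (fun y => G y i l) x - pd l (fun y => G y i j) x)

/-- The vector `Γ(x)(v, w)` with components `∑ᵢⱼ Γᵏ_{ij}(x) vⁱ wʲ`. -/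
def christoffelVec (x v w : Coord n) : Coord n :=
  WithLp.toLp 2 fun k => ∑ i, ∑ j, christoffel G x k i j * v i * w j

/-- Components of the curvature tensor: `R(∂ᵢ, ∂ⱼ)∂ₖ = ∑ₗ (curvatureCoeff G x l i j k) ∂ₗ` for
`R(X, Y)Z = ∇_X ∇_Y Z - ∇_Y ∇_X Z - ∇_{[X, Y]} Z`. -/
def curvatureCoeff (x : Coord n) (l i j k : Fin n) : ℝ :=
  pd i (fun y => christoffel G y l j k) x - pd j (fun y => christoffel G y l i k) x
    + ∑ m, (christoffel G x l i m * christoffel G x m j k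
      - christoffel G x l j m * christoffel G x m i k)

/-- The vector `R(u, v)w` at `x` in coordinates. -/
def curvatureVec (x u v w : Coord n) : Coord n :=
  WithLp.toLp 2 fun l => ∑ i, ∑ j, ∑ k, curvatureCoeff G x l i j k * u i * v j * w k

/-- The Lagrangian `g(τ, τ) ^ (p / 2)` as a function of position `x`, velocity `v` and acceleration
`a`, where the tension field has the components `τᵏ = aᵏ + ∑ᵢⱼ Γᵏ_{ij}(x) vⁱ vʲ`. -/
def lagrangian (p : ℝ) (x v a : Coord n) : ℝ :=
  (∑ i, ∑ j, G x i j * (a + christoffelVec G x v v) i * (a + christoffelVec G x v v) j) ^ (p / 2)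

/-- `∂L/∂γᵏ` evaluated along the coordinate curve `c`, at the parameter `t`. -/
def dLagPos (p : ℝ) (I : Set ℝ) (c : ℝ → Coord n) (k : Fin n) (t : ℝ) : ℝ :=
  pd k (fun x => lagrangian G p x (derivWithin c I t) (derivWithin (derivWithin c I) I t)) (c t)

/-- `∂L/∂γ'ᵏ` evaluated along the coordinate curve `c`, at the parameter `t`. -/
def dLagVel (p : ℝ) (I : Set ℝ) (c : ℝ → Coord n) (k : Fin n) (t : ℝ) : ℝ :=
  pd k (fun v => lagrangian G p (c t) v (derivWithin (derivWithin c I) I t)) (derivWithin c I t)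

/-- `∂L/∂γ''ᵏ` evaluated along the coordinate curve `c`, at the parameter `t`. -/
def dLagAcc (p : ℝ) (I : Set ℝ) (c : ℝ → Coord n) (k : Fin n) (t : ℝ) : ℝ :=
  pd k (fun a => lagrangian G p (c t) (derivWithin c I t) a) (derivWithin (derivWithin c I) I t)

/-- The coordinate curve `c` satisfies the `k`-th Euler-Lagrange equation
`d²/ds² (∂L/∂γ''ᵏ) - d/ds (∂L/∂γ'ᵏ) + ∂L/∂γᵏ = 0` at the parameter `s`; the derivatives with
respect to `s` occurring in it are required to exist. -/
structure EulerLagrangeAt (p : ℝ) (I : Set ℝ) (c : ℝ → Coord n) (k : Fin n) (s : ℝ) : Prop where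
  diff_acc : ∀ᶠ t in 𝓝[I] s, DifferentiableWithinAt ℝ (dLagAcc G p I c k) I t
  diff_deriv_acc : DifferentiableWithinAt ℝ (derivWithin (dLagAcc G p I c k) I) I s
  diff_vel : DifferentiableWithinAt ℝ (dLagVel G p I c k) I s
  equation : derivWithin (derivWithin (dLagAcc G p I c k) I) I s
    - derivWithin (dLagVel G p I c k) I s + dLagPos G p I c k s = 0

end Local

/-! ### Curves in a Riemannian manifold -/

section Manifold

variable {n : ℕ} {M : Type*} [TopologicalSpace M] [ChartedSpace (Coord n) M]
  [IsManifold (𝓡 n) ∞ M]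

variable (n M) in
/-- Smooth Riemannian metrics on the `n`-dimensional manifold `M`. -/
abbrev Metric : Type _ :=
  Bundle.ContMDiffRiemannianMetric (𝓡 n) ∞ (Coord n) (fun x : M => TangentSpace (𝓡 n) x)

/-- The components `g(∂ᵢ, ∂ⱼ)` of the metric in the chart `φ`, on the target of `φ`. -/
def metricIn (g : Metric n M) (φ : OpenPartialHomeomorph M (Coord n)) (x : Coord n) :
    Matrix (Fin n) (Fin n) ℝ :=
  Matrix.of fun i j => g.inner (φ.symm x)
    (mfderiv (𝓡 n) (𝓡 n) φ.symm x (stdVec i)) (mfderiv (𝓡 n) (𝓡 n) φ.symm x (stdVec j))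

/-- The coordinates of the tangent vector `v` at `q` in the chart `φ`. -/
def vecIn (φ : OpenPartialHomeomorph M (Coord n)) (q : M) (v : TangentSpace (𝓡 n) q) : Coord n :=
  mfderiv (𝓡 n) (𝓡 n) φ q v

/-- The tangent vector at `q` whose coordinates in the preferred chart at `q` are `w`. -/
def ofCoord (q : M) (w : Coord n) : TangentSpace (𝓡 n) q :=
  (mfderiv (𝓡 n) (𝓡 n) (chartAt (Coord n) q) q).inverse w

/-- The norm `|v|` of a tangent vector. -/
def normAt (g : Metric n M) (q : M) (v : TangentSpace (𝓡 n) q) : ℝ := √(g.inner q v v)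

/-- The Riemannian curvature `R(u, v)w` at `q`, computed in the preferred chart at `q`. -/
def curvature (g : Metric n M) (q : M) (u v w : TangentSpace (𝓡 n) q) : TangentSpace (𝓡 n) q :=
  let φ := chartAt (Coord n) q
  ofCoord q (curvatureVec (metricIn g φ) (φ q) (vecIn φ q u) (vecIn φ q v) (vecIn φ q w))

/-- The velocity `γ'` of a curve on the interval `I`. -/
def velocity (γ : ℝ → M) (I : Set ℝ) (s : ℝ) : TangentSpace (𝓡 n) (γ s) :=
  mfderivWithin 𝓘(ℝ) (𝓡 n) γ I s (1 : ℝ)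

/-- The Levi-Civita covariant derivative `∇_{γ'} V` of a vector field `V` along `γ`, with the
components `d/ds Vᵏ + ∑ᵢⱼ Γᵏ_{ij} γ'ⁱ Vʲ`, computed at `s` in the preferred chart at `γ s`. -/
def covDeriv (g : Metric n M) (γ : ℝ → M) (I : Set ℝ) (V : (s : ℝ) → TangentSpace (𝓡 n) (γ s))
    (s : ℝ) : TangentSpace (𝓡 n) (γ s) :=
  let φ := chartAt (Coord n) (γ s)
  ofCoord (γ s) (derivWithin (fun t => vecIn φ (γ t) (V t)) I s
    + christoffelVec (metricIn g φ) (φ (γ s)) (vecIn φ (γ s) (velocity γ I s))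
        (vecIn φ (γ s) (V s)))

/-- The tension field `τ(γ) = ∇_{γ'} γ'`. -/
def tension (g : Metric n M) (γ : ℝ → M) (I : Set ℝ) (s : ℝ) : TangentSpace (𝓡 n) (γ s) :=
  covDeriv g γ I (velocity γ I) s

/-- The vector field `|τ(γ)|^{p-2} τ(γ)` along `γ`. -/
def pTension (g : Metric n M) (p : ℝ) (γ : ℝ → M) (I : Set ℝ) (s : ℝ) :
    TangentSpace (𝓡 n) (γ s) :=
  normAt g (γ s) (tension g γ I s) ^ (p - 2) • tension g γ I s

/-- The vector field `V` along `γ` is differentiable at `s`, as a curve in the tangent bundle. -/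
def DiffAlongAt (γ : ℝ → M) (I : Set ℝ) (V : (s : ℝ) → TangentSpace (𝓡 n) (γ s)) (s : ℝ) : Prop :=
  MDifferentiableWithinAt 𝓘(ℝ) (𝓡 n).tangent
    (fun t => (⟨γ t, V t⟩ : TangentBundle (𝓡 n) M)) I s

/-- The curve `γ` satisfies the `p`-biharmonic curve equation
`∇_{γ'} ∇_{γ'} (|∇_{γ'}γ'|^{p-2} ∇_{γ'}γ') - |∇_{γ'}γ'|^{p-2} R(γ', ∇_{γ'}γ')γ' = 0` at the
parameter `s`; the covariant derivatives occurring in it are required to exist. -/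
structure PBiharmonicAt (g : Metric n M) (p : ℝ) (γ : ℝ → M) (I : Set ℝ) (s : ℝ) : Prop where
  diff : ∀ᶠ t in 𝓝[I] s, DiffAlongAt γ I (pTension g p γ I) t
  diff_covDeriv : DiffAlongAt γ I (covDeriv g γ I (pTension g p γ I)) s
  equation : covDeriv g γ I (covDeriv g γ I (pTension g p γ I)) s
    - normAt g (γ s) (tension g γ I s) ^ (p - 2) •
        curvature g (γ s) (velocity γ I s) (tension g γ I s) (velocity γ I s) = 0

end Manifold

end PBiharmonic

end

/-!
The statement is first proved in a single chart, with the coordinate expressions read as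
multilinear forms: the metric as `B`, the Christoffel symbols as a bilinear map `Γ`, related by
`IsLeviCivitaOn`. Let `v = c'` be the velocity of the coordinate curve `c`, `τ = c'' + Γ(v, v)` its
tension, `W = |τ|^{p-2} τ`, and let `D` be the covariant derivative along `c`. The partial
derivatives of the Lagrangian `B(τ, τ)^{p/2}` in the coordinate direction `e` are

* `p B(W, e)` in the acceleration,
* `2 p B(W, Γ(e, v))` in the velocity,
* `p (½ (∂ₑB)(W, τ) + B(W, (∂ₑΓ)(v, v)))` in the position.

The chain rule is available at a zero of `τ` because `p / 2 ≥ 1` whenever `τ` may vanish. Since `Γ`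
is compatible with `B`, differentiating `B(W, e)` along `c` produces `B(D W, e) + B(W, Γ(v, e))`,
and since `W` is a multiple of `τ`, `½ (∂ₑB)(W, τ) = B(W, Γ(e, τ))`. All terms with `Γ` then
assemble to a curvature, and the Euler-Lagrange expression equals
`p (B(D D W, e) + B(W, R(e, v)v)) = p B(D D W - |τ|^{p-2} R(v, τ)v, e)` by the pair symmetry of `R`
(`IsLeviCivitaOn.eulerLagrange_eq`). As `B` is smooth and nondegenerate, differentiability of the
covariant components `B(W, e)` and of their derivatives is equivalent to differentiability of `W`
and `D W`, so that both equations also require the same derivatives to exist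
(`IsMetricOn.coordPBiharmonicAt_iff`).

It remains to see that the `p`-biharmonic equation, which is defined with the preferred chart at
each point of the curve, has the same coordinate expression in every chart. Changes of charts are
isometries for the coordinate metrics. The transformation law of `Γ` follows from the uniqueness of
the Levi-Civita connection (`IsIsometryOn.fderiv_connection`); differentiating it once more gives
the tensoriality of the curvature (`IsIsometryOn.fderiv_curvature`), and it yields the invariance of
the covariant derivative along curves (`IsIsometryOn.formCovDeriv`). Hence the equation on the
manifold at `s` is equivalent to the one in any chart around `γ s` (`pBiharmonicAt_iff`).
-/

open scoped Manifold ContDiff Topology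

noncomputable section

namespace PBiharmonic

/-! ### Metrics and Levi-Civita connections on open subsets of a normed space -/

section Abstract

variable {E : Type*} [NormedAddCommGroup E] [NormedSpace ℝ E]

/-- `B` is a smooth Riemannian metric on the open set `U` of the normed space `E`, and `Γ` is the
Christoffel form of its Levi-Civita connection, so that `∇_u V = D_u V + Γ(u, V)`. The last two
fields say that the connection is torsion-free and compatible with the metric. -/
structure IsLeviCivitaOn (B : E → E →L[ℝ] E →L[ℝ] ℝ) (Γ : E → E →L[ℝ] E →L[ℝ] E)
    (U : Set E) : Prop where
  isOpen : IsOpen U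
  contDiffOn_metric : ContDiffOn ℝ ∞ B U
  contDiffOn_connection : ContDiffOn ℝ ∞ Γ U
  symm : ∀ x ∈ U, ∀ u v, B x u v = B x v u
  pos : ∀ x ∈ U, ∀ u, u ≠ 0 → 0 < B x u u
  torsionFree : ∀ x ∈ U, ∀ u v, Γ x u v = Γ x v u
  compat : ∀ x ∈ U, ∀ z u v, fderiv ℝ B x z u v = B x (Γ x z u) v + B x u (Γ x z v)

/-- The curvature `R(u, v)w` at `x` of the connection with Christoffel form `Γ`. -/
def formCurvature (Γ : E → E →L[ℝ] E →L[ℝ] E) (x u v w : E) : E :=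
  fderiv ℝ Γ x u v w - fderiv ℝ Γ x v u w + Γ x u (Γ x v w) - Γ x v (Γ x u w)

namespace IsLeviCivitaOn

variable {B : E → E →L[ℝ] E →L[ℝ] ℝ} {Γ : E → E →L[ℝ] E →L[ℝ] E} {U : Set E} {x : E}

theorem contDiffAt_metric (h : IsLeviCivitaOn B Γ U) (hx : x ∈ U) : ContDiffAt ℝ ∞ B x :=
  h.contDiffOn_metric.contDiffAt (h.isOpen.mem_nhds hx)

theorem contDiffAt_connection (h : IsLeviCivitaOn B Γ U) (hx : x ∈ U) : ContDiffAt ℝ ∞ Γ x :=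
  h.contDiffOn_connection.contDiffAt (h.isOpen.mem_nhds hx)

theorem hasFDerivAt_metric (h : IsLeviCivitaOn B Γ U) (hx : x ∈ U) :
    HasFDerivAt B (fderiv ℝ B x) x :=
  ((h.contDiffAt_metric hx).differentiableAt (by simp)).hasFDerivAt

theorem hasFDerivAt_connection (h : IsLeviCivitaOn B Γ U) (hx : x ∈ U) :
    HasFDerivAt Γ (fderiv ℝ Γ x) x :=
  ((h.contDiffAt_connection hx).differentiableAt (by simp)).hasFDerivAt

theorem eq_zero_of_forall (h : IsLeviCivitaOn B Γ U) (hx : x ∈ U) {u : E}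
    (hu : ∀ v, B x u v = 0) : u = 0 := by
  by_contra hne
  exact (h.pos x hx u hne).ne' (hu u)

theorem fderiv_connection_symm (h : IsLeviCivitaOn B Γ U) (hx : x ∈ U) (y u v : E) :
    fderiv ℝ Γ x y u v = fderiv ℝ Γ x y v u := by
  have h1 := ((h.hasFDerivAt_connection hx).clm_apply (hasFDerivAt_const u x)).clm_apply
    (hasFDerivAt_const v x)
  have h2 := ((h.hasFDerivAt_connection hx).clm_apply (hasFDerivAt_const v x)).clm_apply
    (hasFDerivAt_const u x)
  have h3 : (fun x => Γ x u v) =ᶠ[𝓝 x] fun x => Γ x v u := by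
    filter_upwards [h.isOpen.mem_nhds hx] with z hz using h.torsionFree z hz u v
  have := DFunLike.congr_fun (h1.unique (h2.congr_of_eventuallyEq h3)) y
  simpa using this

theorem contDiffAt_metric_apply (h : IsLeviCivitaOn B Γ U) (hx : x ∈ U) (u w : E) :
    ContDiffAt ℝ ∞ (fun q => B q u w) x :=
  ((h.contDiffAt_metric hx).clm_apply contDiffAt_const).clm_apply contDiffAt_const

theorem fderiv_metric_apply (h : IsLeviCivitaOn B Γ U) (hx : x ∈ U) (z u w : E) :
    fderiv ℝ (fun q => B q u w) x z = fderiv ℝ B x z u w := by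
  rw [(((h.hasFDerivAt_metric hx).clm_apply (hasFDerivAt_const u x)).clm_apply
    (hasFDerivAt_const w x)).fderiv]
  simp

/-- The derivative of the identity expressing compatibility with the metric. -/
theorem second_compat (h : IsLeviCivitaOn B Γ U) (hx : x ∈ U) (y z u w : E) :
    fderiv ℝ (fderiv ℝ fun q => B q u w) x y z =
      fderiv ℝ B x y (Γ x z u) w + B x (fderiv ℝ Γ x y z u) w
        + (fderiv ℝ B x y u (Γ x z w) + B x u (fderiv ℝ Γ x y z w)) := by
  have hB := h.hasFDerivAt_metric hx
  have hΓ := h.hasFDerivAt_connection hx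
  have hB' : HasFDerivAt (fderiv ℝ fun q => B q u w) (fderiv ℝ (fderiv ℝ fun q => B q u w) x) x :=
    (((h.contDiffAt_metric_apply hx u w).fderiv_right (m := 1) (by norm_cast)).differentiableAt
      (by simp)).hasFDerivAt
  have e1 := hB'.clm_apply (hasFDerivAt_const z x)
  have e2 := (hB.clm_apply ((hΓ.clm_apply (hasFDerivAt_const z x)).clm_apply
    (hasFDerivAt_const u x))).clm_apply (hasFDerivAt_const w x)
  have e3 := (hB.clm_apply (hasFDerivAt_const u x)).clm_apply
    ((hΓ.clm_apply (hasFDerivAt_const z x)).clm_apply (hasFDerivAt_const w x))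
  have h3 : (fun x => fderiv ℝ (fun q => B q u w) x z) =ᶠ[𝓝 x]
      fun x => B x (Γ x z u) w + B x u (Γ x z w) := by
    filter_upwards [h.isOpen.mem_nhds hx] with q hq
    rw [h.fderiv_metric_apply hq, h.compat q hq z u w]
  have := DFunLike.congr_fun (e1.unique ((e2.add e3).congr_of_eventuallyEq h3)) y
  simp at this
  rw [this]
  ring

/-- The curvature is skew for the metric: antisymmetrize `second_compat`, whose left-hand side is
symmetric in `y` and `z`. -/
theorem curvature_skew (h : IsLeviCivitaOn B Γ U) (hx : x ∈ U) (y z u w : E) :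
    B x (formCurvature Γ x y z u) w = - B x (formCurvature Γ x y z w) u := by
  have hs : fderiv ℝ (fderiv ℝ fun q => B q u w) x y z
      = fderiv ℝ (fderiv ℝ fun q => B q u w) x z y :=
    ((h.contDiffAt_metric_apply hx u w).isSymmSndFDerivAt
      (by rw [minSmoothness_of_isRCLikeNormedField]; norm_cast)).eq y z
  have h1 := h.second_compat hx y z u w
  have h2 := h.second_compat hx z y u w
  rw [hs, h2] at h1
  simp only [h.compat x hx] at h1
  rw [h.symm x hx (formCurvature Γ x y z w) u]
  simp only [formCurvature, map_add, map_sub, add_apply,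
    sub_apply]
  linarith

theorem curvature_antisymm (y z u : E) :
    formCurvature Γ x y z u = - formCurvature Γ x z y u := by
  simp only [formCurvature]; abel

theorem curvature_bianchi (h : IsLeviCivitaOn B Γ U) (hx : x ∈ U) (y z u : E) :
    formCurvature Γ x y z u + formCurvature Γ x z u y + formCurvature Γ x u y z = 0 := by
  simp only [formCurvature]
  rw [h.fderiv_connection_symm hx y z u, h.fderiv_connection_symm hx z u y,
    h.fderiv_connection_symm hx u y z, h.torsionFree x hx z u, h.torsionFree x hx u y,
    h.torsionFree x hx y z]
  abel

/-- Pair symmetry, from the four Bianchi identities for the cyclic rotations of the arguments. -/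
theorem curvature_pair_symm (h : IsLeviCivitaOn B Γ U) (hx : x ∈ U) (y z u w : E) :
    B x (formCurvature Γ x y z u) w = B x (formCurvature Γ x u w y) z := by
  have hb : ∀ a b c d : E, B x (formCurvature Γ x a b c) d + B x (formCurvature Γ x b c a) d
      + B x (formCurvature Γ x c a b) d = 0 := fun a b c d => by
    have := congrArg (fun e => B x e d) (h.curvature_bianchi hx a b c)
    simpa using this
  have ha : ∀ a b c d : E, B x (formCurvature Γ x a b c) d = - B x (formCurvature Γ x b a c) d :=
    fun a b c d => by rw [curvature_antisymm (Γ := Γ) a b c]; simp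
  have hs := h.curvature_skew hx
  linarith [hb y z u w, hb z u w y, hb u w y z, hb w y z u, hs z u w y, hs u w z y, ha w z u y,
    hs z w u y, ha y u w z, hs u y w z, hs y z w u, hs w y z u]

end IsLeviCivitaOn

end Abstract

/-! ### Change of coordinates -/

section ChangeOfCoordinates

variable {E : Type*} [NormedAddCommGroup E] [NormedSpace ℝ E]

/-- `f` is a smooth local isometry on the open set `V` from the metric `B₁` to the metric `B₂`.
Only surjectivity of the derivative is required; injectivity follows if `B₁` is positive. -/
structure IsIsometryOn (B₁ B₂ : E → E →L[ℝ] E →L[ℝ] ℝ) (f : E → E) (V : Set E) : Prop where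
  isOpen : IsOpen V
  contDiffOn : ContDiffOn ℝ ∞ f V
  surjective : ∀ x ∈ V, Function.Surjective (fderiv ℝ f x)
  metric_eq : ∀ x ∈ V, ∀ u v, B₁ x u v = B₂ (f x) (fderiv ℝ f x u) (fderiv ℝ f x v)

variable {B₁ B₂ : E → E →L[ℝ] E →L[ℝ] ℝ} {Γ₁ Γ₂ : E → E →L[ℝ] E →L[ℝ] E} {U₁ U₂ V : Set E}
  {f : E → E} {x : E}

namespace IsIsometryOn

theorem contDiffAt (hf : IsIsometryOn B₁ B₂ f V) (hx : x ∈ V) : ContDiffAt ℝ ∞ f x :=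
  hf.contDiffOn.contDiffAt (hf.isOpen.mem_nhds hx)

theorem hasFDerivAt (hf : IsIsometryOn B₁ B₂ f V) (hx : x ∈ V) :
    HasFDerivAt f (fderiv ℝ f x) x :=
  ((hf.contDiffAt hx).differentiableAt (by simp)).hasFDerivAt

theorem contDiffAt_fderiv (hf : IsIsometryOn B₁ B₂ f V) (hx : x ∈ V) :
    ContDiffAt ℝ ∞ (fderiv ℝ f) x :=
  (hf.contDiffAt hx).fderiv_right (by norm_cast)

theorem hasFDerivAt_fderiv (hf : IsIsometryOn B₁ B₂ f V) (hx : x ∈ V) :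
    HasFDerivAt (fderiv ℝ f) (fderiv ℝ (fderiv ℝ f) x) x :=
  ((hf.contDiffAt_fderiv hx).differentiableAt (by simp)).hasFDerivAt

theorem fderiv_fderiv_symm (hf : IsIsometryOn B₁ B₂ f V) (hx : x ∈ V) (u v : E) :
    fderiv ℝ (fderiv ℝ f) x u v = fderiv ℝ (fderiv ℝ f) x v u :=
  ((hf.contDiffAt hx).isSymmSndFDerivAt
    (by rw [minSmoothness_of_isRCLikeNormedField]; norm_cast)).eq u v

variable (h₁ : IsLeviCivitaOn B₁ Γ₁ U₁) (h₂ : IsLeviCivitaOn B₂ Γ₂ U₂) (hV : V ⊆ U₁)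
  (hfV : Set.MapsTo f V U₂)

include h₁ h₂ hV hfV

/-- The derivative of `B₁(u, v) = B₂(f' u, f' v)` in the direction `z`. -/
theorem fderiv_metric (hf : IsIsometryOn B₁ B₂ f V) (hx : x ∈ V) (z u v : E) :
    fderiv ℝ B₁ x z u v =
      fderiv ℝ B₂ (f x) (fderiv ℝ f x z) (fderiv ℝ f x u) (fderiv ℝ f x v)
        + B₂ (f x) (fderiv ℝ (fderiv ℝ f) x z u) (fderiv ℝ f x v)
        + B₂ (f x) (fderiv ℝ f x u) (fderiv ℝ (fderiv ℝ f) x z v) := by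
  have e1 := ((h₁.hasFDerivAt_metric (hV hx)).clm_apply (hasFDerivAt_const u x)).clm_apply
    (hasFDerivAt_const v x)
  have hf' := hf.hasFDerivAt_fderiv hx
  have hB : HasFDerivAt (fun q => B₂ (f q)) (fderiv ℝ B₂ (f x) ∘L fderiv ℝ f x) x :=
    HasFDerivAt.comp (g := B₂) x (h₂.hasFDerivAt_metric (hfV hx)) (hf.hasFDerivAt hx)
  have e2 := (hB.clm_apply
    (hf'.clm_apply (hasFDerivAt_const u x))).clm_apply (hf'.clm_apply (hasFDerivAt_const v x))
  have h3 : (fun x => B₁ x u v) =ᶠ[𝓝 x]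
      fun x => B₂ (f x) (fderiv ℝ f x u) (fderiv ℝ f x v) := by
    filter_upwards [hf.isOpen.mem_nhds hx] with q hq using hf.metric_eq q hq u v
  have := DFunLike.congr_fun (e1.unique (e2.congr_of_eventuallyEq h3)) z
  simp at this
  rw [this]
  ring

/-- The transformation law of Christoffel symbols. The defect of the law, paired with the image of
a third vector, is symmetric in the first two arguments and skew in the last two, hence zero: this
is the uniqueness of the Levi-Civita connection. -/
theorem fderiv_connection (hf : IsIsometryOn B₁ B₂ f V) (hx : x ∈ V) (u v : E) :
    fderiv ℝ f x (Γ₁ x u v) =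
      fderiv ℝ (fderiv ℝ f) x u v + Γ₂ (f x) (fderiv ℝ f x u) (fderiv ℝ f x v) := by
  set D : E → E → E := fun u v => fderiv ℝ f x (Γ₁ x u v)
    - (fderiv ℝ (fderiv ℝ f) x u v + Γ₂ (f x) (fderiv ℝ f x u) (fderiv ℝ f x v)) with hD
  have hsymm : ∀ u v, D u v = D v u := fun u v => by
    simp only [hD, h₁.torsionFree x (hV hx) u v, hf.fderiv_fderiv_symm hx u v,
      h₂.torsionFree (f x) (hfV hx) (fderiv ℝ f x u)]
  have hskew : ∀ z u v, B₂ (f x) (D z u) (fderiv ℝ f x v)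
      = - B₂ (f x) (D z v) (fderiv ℝ f x u) := fun z u v => by
    have e := hf.fderiv_metric h₁ h₂ hV hfV hx z u v
    rw [h₁.compat x (hV hx), h₂.compat (f x) (hfV hx), hf.metric_eq x hx, hf.metric_eq x hx] at e
    rw [h₂.symm (f x) (hfV hx) (D z v)]
    simp only [hD, map_add, map_sub, add_apply, sub_apply]
    linarith
  -- a trilinear form that is symmetric in one pair of arguments and skew in another vanishes
  have hzero : D u v = 0 := by
    apply h₂.eq_zero_of_forall (hfV hx)
    intro w
    obtain ⟨w, rfl⟩ := hf.surjective x hx w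
    have a1 := hskew u v w
    have a2 := hskew w u v
    have a3 := hskew v w u
    rw [hsymm u w] at a1
    rw [hsymm w v] at a2
    rw [hsymm v u] at a3
    linarith
  exact sub_eq_zero.1 hzero

/-- The curvature is a tensor: the second derivatives of the change of coordinates cancel. -/
theorem fderiv_curvature (hf : IsIsometryOn B₁ B₂ f V) (hx : x ∈ V) (u v w : E) :
    fderiv ℝ f x (formCurvature Γ₁ x u v w) =
      formCurvature Γ₂ (f x) (fderiv ℝ f x u) (fderiv ℝ f x v) (fderiv ℝ f x w) := by
  have law := fun u v => hf.fderiv_connection h₁ h₂ hV hfV hx u v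
  have hf' := hf.hasFDerivAt_fderiv hx
  -- the derivative in the direction `u` of the transformation law for `Γ(v, w)`
  have key : ∀ u v w, fderiv ℝ (fderiv ℝ f) x u (Γ₁ x v w) + fderiv ℝ f x (fderiv ℝ Γ₁ x u v w)
      = fderiv ℝ (fderiv ℝ fun q => fderiv ℝ f q w) x u v
        + (fderiv ℝ Γ₂ (f x) (fderiv ℝ f x u) (fderiv ℝ f x v) (fderiv ℝ f x w)
          + Γ₂ (f x) (fderiv ℝ (fderiv ℝ f) x u v) (fderiv ℝ f x w)
          + Γ₂ (f x) (fderiv ℝ f x v) (fderiv ℝ (fderiv ℝ f) x u w)) := fun u v w => by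
    have e1 := hf'.clm_apply (((h₁.hasFDerivAt_connection (hV hx)).clm_apply
      (hasFDerivAt_const v x)).clm_apply (hasFDerivAt_const w x))
    have hw : HasFDerivAt (fderiv ℝ fun q => fderiv ℝ f q w)
        (fderiv ℝ (fderiv ℝ fun q => fderiv ℝ f q w) x) x :=
      ((((hf.contDiffAt_fderiv hx).clm_apply contDiffAt_const).fderiv_right (m := 1)
        (by norm_cast)).differentiableAt (by simp)).hasFDerivAt
    have e2 := (hw.clm_apply (hasFDerivAt_const v x)).add
      ((((h₂.hasFDerivAt_connection (hfV hx)).comp x (hf.hasFDerivAt hx)).clm_apply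
        (hf'.clm_apply (hasFDerivAt_const v x))).clm_apply (hf'.clm_apply (hasFDerivAt_const w x)))
    have h3 : (fun x => fderiv ℝ f x (Γ₁ x v w)) =ᶠ[𝓝 x] fun x =>
        fderiv ℝ (fun q => fderiv ℝ f q w) x v
          + Γ₂ (f x) (fderiv ℝ f x v) (fderiv ℝ f x w) := by
      filter_upwards [hf.isOpen.mem_nhds hx] with q hq
      rw [hf.fderiv_connection h₁ h₂ hV hfV hq,
        ((hf.hasFDerivAt_fderiv hq).clm_apply (hasFDerivAt_const w q)).fderiv]
      simp
    have := DFunLike.congr_fun (e1.unique (e2.congr_of_eventuallyEq h3)) u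
    simp at this
    rw [add_comm, this]
    abel
  have h3 : fderiv ℝ (fderiv ℝ fun q => fderiv ℝ f q w) x u v
      = fderiv ℝ (fderiv ℝ fun q => fderiv ℝ f q w) x v u :=
    (((hf.contDiffAt_fderiv hx).clm_apply contDiffAt_const).isSymmSndFDerivAt
      (by rw [minSmoothness_of_isRCLikeNormedField]; norm_cast)).eq u v
  have k1 := eq_sub_of_add_eq' (key u v w)
  have k2 := eq_sub_of_add_eq' (key v u w)
  simp only [formCurvature, map_add, map_sub, k1, k2, law, h3, hf.fderiv_fderiv_symm hx v u]
  abel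

end IsIsometryOn

end ChangeOfCoordinates

/-! ### Covariant derivatives along curves in coordinates -/

section AlongCurve

variable {E : Type*} [NormedAddCommGroup E] [NormedSpace ℝ E]

/-- The covariant derivative `W' + Γ(c', W)` along the coordinate curve `c` on `I`. -/
def formCovDeriv (Γ : E → E →L[ℝ] E →L[ℝ] E) (I : Set ℝ) (c W : ℝ → E) (t : ℝ) : E :=
  derivWithin W I t + Γ (c t) (derivWithin c I t) (W t)

variable {B B₂ : E → E →L[ℝ] E →L[ℝ] ℝ} {Γ Γ₂ : E → E →L[ℝ] E →L[ℝ] E} {U U₂ V : Set E}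
  {I : Set ℝ} {c W Z : ℝ → E} {s t : ℝ}

theorem differentiableWithinAt_inverse {F G : Type*} [NormedAddCommGroup F] [NormedSpace ℝ F]
    [CompleteSpace F] [NormedAddCommGroup G] [NormedSpace ℝ G] {A : ℝ → F →L[ℝ] G}
    (hA : DifferentiableWithinAt ℝ A I t) (L : F ≃L[ℝ] G) (hL : (L : F →L[ℝ] G) = A t) :
    DifferentiableWithinAt ℝ (fun t => (A t).inverse) I t := by
  have h : DifferentiableAt ℝ ContinuousLinearMap.inverse (A t) := by
    rw [← hL]
    exact (contDiffAt_map_inverse (n := 1) L).differentiableAt (by simp)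
  exact h.comp_differentiableWithinAt t hA

theorem differentiableWithinAt_clm_of_basis {ι : Type*} [Fintype ι] [FiniteDimensional ℝ E]
    (b : Module.Basis ι ℝ E) {A : ℝ → E →L[ℝ] ℝ}
    (hA : ∀ i, DifferentiableWithinAt ℝ (fun t => A t (b i)) I t) :
    DifferentiableWithinAt ℝ A I t := by
  have h : A = fun t => ∑ i, A t (b i) • LinearMap.toContinuousLinearMap (b.coord i) := by
    funext t
    ext u
    conv_lhs => rw [← b.sum_repr u, map_sum]
    simp [mul_comm]
  rw [h]
  exact DifferentiableWithinAt.fun_sum fun i _ => (hA i).smul_const _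

theorem formCovDeriv_congr {c' W' : ℝ → E} (hc : c' =ᶠ[𝓝[I] t] c) (hW : W' =ᶠ[𝓝[I] t] W)
    (ht : t ∈ I) : formCovDeriv Γ I c' W' t = formCovDeriv Γ I c W t := by
  simp only [formCovDeriv, hc.derivWithin_eq (hc.self_of_nhdsWithin ht),
    hW.derivWithin_eq (hW.self_of_nhdsWithin ht), hc.self_of_nhdsWithin ht,
    hW.self_of_nhdsWithin ht]

/-- Covariant differentiation along curves commutes with local isometries. -/
theorem IsIsometryOn.formCovDeriv {f : E → E} (hf : IsIsometryOn B B₂ f V)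
    (h₁ : IsLeviCivitaOn B Γ U) (h₂ : IsLeviCivitaOn B₂ Γ₂ U₂) (hV : V ⊆ U)
    (hfV : Set.MapsTo f V U₂) (hI : UniqueDiffWithinAt ℝ I t) (ht : c t ∈ V)
    (hc : DifferentiableWithinAt ℝ c I t) (hW : DifferentiableWithinAt ℝ W I t) :
    formCovDeriv Γ₂ I (fun t => f (c t)) (fun t => fderiv ℝ f (c t) (W t)) t
      = fderiv ℝ f (c t) (formCovDeriv Γ I c W t) := by
  have e1 : HasDerivWithinAt (fun t => f (c t)) (fderiv ℝ f (c t) (derivWithin c I t)) I t :=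
    HasFDerivAt.comp_hasDerivWithinAt t (hf.hasFDerivAt ht) hc.hasDerivWithinAt
  have e2 : HasDerivWithinAt (fun t => fderiv ℝ f (c t))
      (fderiv ℝ (fderiv ℝ f) (c t) (derivWithin c I t)) I t :=
    HasFDerivAt.comp_hasDerivWithinAt t (hf.hasFDerivAt_fderiv ht) hc.hasDerivWithinAt
  have e3 := e2.clm_apply hW.hasDerivWithinAt
  simp only [PBiharmonic.formCovDeriv]
  rw [e1.derivWithin hI, e3.derivWithin hI, map_add, hf.fderiv_connection h₁ h₂ hV hfV ht]
  abel

namespace IsLeviCivitaOn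

/-- The product rule for the metric and the covariant derivative along a curve. -/
theorem hasDerivWithinAt_metric (h : IsLeviCivitaOn B Γ U) (ht : c t ∈ U)
    {v W' Z' : E} (hc : HasDerivWithinAt c v I t)
    (hW : HasDerivWithinAt W W' I t) (hZ : HasDerivWithinAt Z Z' I t) :
    HasDerivWithinAt (fun t => B (c t) (W t) (Z t))
      (B (c t) (W' + Γ (c t) v (W t)) (Z t) + B (c t) (W t) (Z' + Γ (c t) v (Z t))) I t := by
  have e1 : HasDerivWithinAt (fun t => B (c t)) (fderiv ℝ B (c t) v) I t :=
    HasFDerivAt.comp_hasDerivWithinAt (l := B) t (h.hasFDerivAt_metric ht) hc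
  refine ((e1.clm_apply hW).clm_apply hZ).congr_deriv ?_
  simp only [map_add, add_apply, h.compat _ ht]
  ring

theorem hasDerivWithinAt_connection (h : IsLeviCivitaOn B Γ U) (ht : c t ∈ U)
    {v W' Z' : E} (hc : HasDerivWithinAt c v I t)
    (hW : HasDerivWithinAt W W' I t) (hZ : HasDerivWithinAt Z Z' I t) :
    HasDerivWithinAt (fun t => Γ (c t) (W t) (Z t))
      (fderiv ℝ Γ (c t) v (W t) (Z t) + Γ (c t) W' (Z t) + Γ (c t) (W t) Z') I t := by
  have e1 : HasDerivWithinAt (fun t => Γ (c t)) (fderiv ℝ Γ (c t) v) I t :=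
    HasFDerivAt.comp_hasDerivWithinAt (l := Γ) t (h.hasFDerivAt_connection ht) hc
  refine ((e1.clm_apply hW).clm_apply hZ).congr_deriv ?_
  simp only [add_apply]

/-- A vector field along a curve is differentiable as soon as its covariant components are. -/
theorem differentiableWithinAt_of_metric {ι : Type*} [Fintype ι] [FiniteDimensional ℝ E]
    (b : Module.Basis ι ℝ E) (h : IsLeviCivitaOn B Γ U) (ht : t ∈ I) (htU : c t ∈ U)
    (hc : DifferentiableWithinAt ℝ c I t)
    (hW : ∀ i, DifferentiableWithinAt ℝ (fun t => B (c t) (W t) (b i)) I t) :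
    DifferentiableWithinAt ℝ W I t := by
  have := FiniteDimensional.complete ℝ E
  -- the metric identifies vectors with covectors, and the inverse depends smoothly on the point
  have hequiv : ∀ x ∈ U, ∃ L : E ≃L[ℝ] (E →L[ℝ] ℝ), (L : E →L[ℝ] E →L[ℝ] ℝ) = B x := by
    intro x hx
    have hinj : Function.Injective (B x : E →ₗ[ℝ] E →L[ℝ] ℝ) := by
      rw [← LinearMap.ker_eq_bot, LinearMap.ker_eq_bot']
      intro u hu
      exact h.eq_zero_of_forall hx fun v => DFunLike.congr_fun hu v
    have hdim : Module.finrank ℝ E = Module.finrank ℝ (E →L[ℝ] ℝ) := by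
      rw [← LinearEquiv.finrank_eq (LinearMap.toContinuousLinearMap (𝕜 := ℝ) (E := E) (F' := ℝ))]
      exact (Subspace.dual_finrank_eq (K := ℝ) (V := E)).symm
    refine ⟨(LinearEquiv.ofInjectiveOfFinrankEq _ hinj hdim).toContinuousLinearEquiv, ?_⟩
    ext u v
    rfl
  have h1 : DifferentiableWithinAt ℝ (fun t => B (c t) (W t)) I t :=
    differentiableWithinAt_clm_of_basis b hW
  have h2 : DifferentiableWithinAt ℝ (fun t => (B (c t)).inverse) I t := by
    obtain ⟨L, hL⟩ := hequiv _ htU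
    exact differentiableWithinAt_inverse (DifferentiableAt.comp_differentiableWithinAt (g := B) t
      (h.hasFDerivAt_metric htU).differentiableAt hc) L hL
  refine (h2.clm_apply h1).congr_of_eventuallyEq_of_mem ?_ ht
  filter_upwards [hc.continuousWithinAt.preimage_mem_nhdsWithin (h.isOpen.mem_nhds htU)] with q hq
  obtain ⟨L, hL⟩ := hequiv _ hq
  rw [← hL]
  simp

end IsLeviCivitaOn

end AlongCurve

/-! ### The Euler-Lagrange expression in covariant form -/

section EulerLagrange

variable {E : Type*} [NormedAddCommGroup E] [NormedSpace ℝ E]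

/-- At parameters near `s`, the coordinate curve `c` lies in `U` and has two derivatives. -/
def TwiceDiffNear (U : Set E) (I : Set ℝ) (c : ℝ → E) (s : ℝ) : Prop :=
  ∀ᶠ t in 𝓝[I] s, c t ∈ U ∧ DifferentiableWithinAt ℝ c I t ∧
    DifferentiableWithinAt ℝ (derivWithin c I) I t

namespace IsLeviCivitaOn

variable {B : E → E →L[ℝ] E →L[ℝ] ℝ} {Γ : E → E →L[ℝ] E →L[ℝ] E} {U : Set E}
  {I : Set ℝ} {c W : ℝ → E} {s t : ℝ}

theorem hasDerivWithinAt_metric_const (h : IsLeviCivitaOn B Γ U) (ht : c t ∈ U)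
    (hc : DifferentiableWithinAt ℝ c I t) (hW : DifferentiableWithinAt ℝ W I t) (e : E) :
    HasDerivWithinAt (fun t => B (c t) (W t) e)
      (B (c t) (formCovDeriv Γ I c W t) e + B (c t) (W t) (Γ (c t) (derivWithin c I t) e)) I t := by
  have := h.hasDerivWithinAt_metric ht hc.hasDerivWithinAt hW.hasDerivWithinAt
    (hasDerivWithinAt_const t I e)
  simpa only [zero_add, formCovDeriv] using this

/-- The derivative of `B(W, Γ(e, c'))` along `c`. -/
theorem hasDerivWithinAt_metric_connection (h : IsLeviCivitaOn B Γ U) (ht : c t ∈ U)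
    (hc : DifferentiableWithinAt ℝ c I t) (hv : DifferentiableWithinAt ℝ (derivWithin c I) I t)
    (hW : DifferentiableWithinAt ℝ W I t) (e : E) :
    HasDerivWithinAt (fun t => B (c t) (W t) (Γ (c t) e (derivWithin c I t)))
      (B (c t) (formCovDeriv Γ I c W t) (Γ (c t) e (derivWithin c I t))
        + B (c t) (W t) (fderiv ℝ Γ (c t) (derivWithin c I t) e (derivWithin c I t)
          + Γ (c t) e (derivWithin (derivWithin c I) I t)
          + Γ (c t) (derivWithin c I t) (Γ (c t) e (derivWithin c I t)))) I t := by
  have := h.hasDerivWithinAt_metric ht hc.hasDerivWithinAt hW.hasDerivWithinAt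
    (h.hasDerivWithinAt_connection ht hc.hasDerivWithinAt (hasDerivWithinAt_const t I e)
      hv.hasDerivWithinAt)
  simpa only [map_zero, zero_apply, add_zero, formCovDeriv] using this

theorem differentiableWithinAt_derivWithin_metric_iff (h : IsLeviCivitaOn B Γ U)
    (hI : UniqueDiffOn ℝ I) (hs : s ∈ I) (hc : TwiceDiffNear U I c s)
    (hW : ∀ᶠ t in 𝓝[I] s, DifferentiableWithinAt ℝ W I t) (e : E) :
    DifferentiableWithinAt ℝ (derivWithin (fun t => B (c t) (W t) e) I) I s ↔
      DifferentiableWithinAt ℝ (fun t => B (c t) (formCovDeriv Γ I c W t) e) I s := by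
  have key : derivWithin (fun t => B (c t) (W t) e) I =ᶠ[𝓝[I] s] fun t =>
      B (c t) (formCovDeriv Γ I c W t) e + B (c t) (W t) (Γ (c t) e (derivWithin c I t)) := by
    filter_upwards [hc, hW, self_mem_nhdsWithin] with t ⟨htU, hct, hvt⟩ hWt htI
    rw [(h.hasDerivWithinAt_metric_const htU hct hWt e).derivWithin (hI t htI),
      h.torsionFree _ htU e]
  obtain ⟨hsU, hcs, hvs⟩ := hc.self_of_nhdsWithin hs
  have h2 := (h.hasDerivWithinAt_metric_connection hsU hcs hvs (hW.self_of_nhdsWithin hs)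
    e).differentiableWithinAt
  rw [key.differentiableWithinAt_iff_of_mem hs]
  exact ⟨fun h1 => by simpa using h1.fun_sub h2, fun h1 => h1.fun_add h2⟩

/-- The Euler-Lagrange expression, divided by `p`, in the coordinate direction `e`. All terms
involving derivatives of the metric combine into the curvature; since `W` is a multiple of the
tension `τ`, the first derivative of the metric contributes `B(W, Γ(e, τ))`. -/
theorem eulerLagrange_eq (h : IsLeviCivitaOn B Γ U)
    (hI : UniqueDiffOn ℝ I) (hs : s ∈ I) (hc : TwiceDiffNear U I c s)
    (hW : ∀ᶠ t in 𝓝[I] s, DifferentiableWithinAt ℝ W I t)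
    (hDW : DifferentiableWithinAt ℝ (formCovDeriv Γ I c W) I s) {l : ℝ} {τ : E}
    (hτ : τ = formCovDeriv Γ I c (derivWithin c I) s) (hWs : W s = l • τ) (e : E) :
    derivWithin (derivWithin (fun t => B (c t) (W t) e) I) I s
      - 2 * derivWithin (fun t => B (c t) (W t) (Γ (c t) e (derivWithin c I t))) I s
      + (1 / 2 * fderiv ℝ B (c s) e (W s) τ
        + B (c s) (W s) (fderiv ℝ Γ (c s) e (derivWithin c I s) (derivWithin c I s)))
    = B (c s) (formCovDeriv Γ I c (formCovDeriv Γ I c W) s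
        - l • formCurvature Γ (c s) (derivWithin c I s) τ (derivWithin c I s)) e := by
  have key : derivWithin (fun t => B (c t) (W t) e) I =ᶠ[𝓝[I] s] fun t =>
      B (c t) (formCovDeriv Γ I c W t) e + B (c t) (W t) (Γ (c t) e (derivWithin c I t)) := by
    filter_upwards [hc, hW, self_mem_nhdsWithin] with t ⟨htU, hct, hvt⟩ hWt htI
    rw [(h.hasDerivWithinAt_metric_const htU hct hWt e).derivWithin (hI t htI),
      h.torsionFree _ htU e]
  obtain ⟨hsU, hcs, hvs⟩ := hc.self_of_nhdsWithin hs
  have h1 := h.hasDerivWithinAt_metric_const hsU hcs hDW e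
  have h2 := h.hasDerivWithinAt_metric_connection hsU hcs hvs (hW.self_of_nhdsWithin hs) e
  rw [key.derivWithin_eq (key.self_of_nhdsWithin hs), (h1.fun_add h2).derivWithin (hI s hs),
    h2.derivWithin (hI s hs)]
  set v := derivWithin c I s
  set a := derivWithin (derivWithin c I) I s
  have hpair : B (c s) (formCurvature Γ (c s) v τ v) e
      = - B (c s) τ (formCurvature Γ (c s) e v v) := by
    rw [h.curvature_skew hsU, h.curvature_pair_symm hsU, h.symm _ hsU]
  have hexp : formCurvature Γ (c s) e v v = fderiv ℝ Γ (c s) e v v - fderiv ℝ Γ (c s) v e v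
      + Γ (c s) e (Γ (c s) v v) - Γ (c s) v (Γ (c s) e v) := rfl
  have hDB : fderiv ℝ B (c s) e (W s) τ = 2 * B (c s) (W s) (Γ (c s) e τ) := by
    rw [hWs, h.compat _ hsU]
    simp only [map_smul, smul_apply, smul_eq_mul]
    rw [h.symm _ hsU (Γ (c s) e τ)]
    ring
  have hτ' : Γ (c s) e τ = Γ (c s) e a + Γ (c s) e (Γ (c s) v v) := by
    rw [hτ, ← map_add]; rfl
  rw [hDB, hτ', hWs]
  simp only [map_sub, map_smul, sub_apply, smul_apply, smul_eq_mul, hpair, hexp, map_add,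
    h.torsionFree _ hsU v e]
  ring

end IsLeviCivitaOn

end EulerLagrange

/-! ### Coordinate expressions as multilinear forms -/

section Coordinates

variable {n : ℕ} {G : Coord n → Matrix (Fin n) (Fin n) ℝ} {U : Set (Coord n)} {x : Coord n}

variable (G) in
/-- The bilinear form `(u, v) ↦ ∑ᵢⱼ G_{ij}(x) uⁱ vʲ`. -/
def metricForm (x : Coord n) : Coord n →L[ℝ] Coord n →L[ℝ] ℝ :=
  ∑ i, ∑ j, G x i j • (EuclideanSpace.proj i : Coord n →L[ℝ] ℝ).smulRight
    (EuclideanSpace.proj j : Coord n →L[ℝ] ℝ)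

variable (G) in
/-- The vector-valued bilinear form whose components are the Christoffel symbols. -/
def connectionForm (x : Coord n) : Coord n →L[ℝ] Coord n →L[ℝ] Coord n :=
  ∑ k, ∑ i, ∑ j, christoffel G x k i j • (EuclideanSpace.proj i : Coord n →L[ℝ] ℝ).smulRight
    ((EuclideanSpace.proj j : Coord n →L[ℝ] ℝ).smulRight (stdVec k))

theorem stdVec_apply (k l : Fin n) : (stdVec k : Coord n) l = if l = k then 1 else 0 := by
  simp [stdVec]

theorem metricForm_apply (u v : Coord n) :
    metricForm G x u v = ∑ i, ∑ j, G x i j * u i * v j := by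
  simp [metricForm, mul_assoc]

theorem connectionForm_apply (u v : Coord n) :
    connectionForm G x u v = christoffelVec G x u v := by
  ext l
  simp only [connectionForm, christoffelVec, sum_apply, smul_apply,
    ContinuousLinearMap.smulRight_apply, PiLp.proj_apply, WithLp.ofLp_sum, Finset.sum_apply,
    PiLp.smul_apply, stdVec_apply, smul_eq_mul]
  rw [Finset.sum_eq_single l (fun k _ hk => by simp [hk.symm]) (by simp)]
  simp [mul_assoc]

theorem sum_smul_stdVec (u : Coord n) : ∑ i, u i • stdVec i = u := by
  ext l
  simp [stdVec_apply]

theorem map_eq_sum {F : Type*} [NormedAddCommGroup F] [NormedSpace ℝ F] (A : Coord n →L[ℝ] F)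
    (u : Coord n) : A u = ∑ i, u i • A (stdVec i) := by
  conv_lhs => rw [← sum_smul_stdVec u, map_sum]
  simp

theorem metricForm_stdVec (i j : Fin n) : metricForm G x (stdVec i) (stdVec j) = G x i j := by
  simp [metricForm_apply, stdVec_apply]

theorem connectionForm_stdVec (i j k : Fin n) :
    connectionForm G x (stdVec i) (stdVec j) k = christoffel G x k i j := by
  simp [connectionForm_apply, christoffelVec, stdVec_apply]

variable (G U) in
/-- The matrix-valued function `G` consists of the components of a smooth Riemannian metric on the
open set `U` of the coordinate space. -/
structure IsMetricOn : Prop where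
  isOpen : IsOpen U
  contDiffOn : ∀ i j, ContDiffOn ℝ ∞ (fun x => G x i j) U
  symm : ∀ x ∈ U, ∀ i j, G x i j = G x j i
  pos : ∀ x ∈ U, ∀ u, u ≠ 0 → 0 < metricForm G x u u

namespace IsMetricOn

theorem det_ne_zero (h : IsMetricOn G U) (hx : x ∈ U) : (G x).det ≠ 0 := by
  intro hdet
  obtain ⟨v, hv, hv0⟩ := Matrix.exists_mulVec_eq_zero_iff.2 hdet
  refine (h.pos x hx (WithLp.toLp 2 v) (by simpa using hv)).ne' ?_
  rw [metricForm_apply]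
  refine Finset.sum_eq_zero fun i _ => ?_
  have := congrFun hv0 i
  simp only [Matrix.mulVec, dotProduct, Pi.zero_apply] at this
  calc ∑ j, G x i j * v i * v j = v i * ∑ j, G x i j * v j := by
        rw [Finset.mul_sum]; exact Finset.sum_congr rfl fun j _ => by ring
    _ = 0 := by rw [this, mul_zero]

theorem contDiffOn_det {A : Coord n → Matrix (Fin n) (Fin n) ℝ}
    (hA : ∀ i j, ContDiffOn ℝ ∞ (fun x => A x i j) U) : ContDiffOn ℝ ∞ (fun x => (A x).det) U := by
  simp only [Matrix.det_apply]
  exact ContDiffOn.sum fun σ _ => (contDiffOn_prod fun i _ => hA _ _).const_smul _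

theorem contDiffOn_inv (h : IsMetricOn G U) (i j : Fin n) :
    ContDiffOn ℝ ∞ (fun x => (G x)⁻¹ i j) U := by
  simp only [Matrix.inv_def, Matrix.smul_apply, Ring.inverse_eq_inv', smul_eq_mul,
    Matrix.adjugate_apply]
  refine (ContDiffOn.inv (contDiffOn_det h.contDiffOn) fun x hx => h.det_ne_zero hx).mul
    (contDiffOn_det fun a b => ?_)
  simp only [Matrix.updateRow_apply]
  split_ifs
  · exact contDiffOn_const
  · exact h.contDiffOn a b

theorem contDiffOn_pd (h : IsMetricOn G U) (k i j : Fin n) :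
    ContDiffOn ℝ ∞ (fun x => pd k (fun y => G y i j) x) U :=
  ((h.contDiffOn i j).fderiv_of_isOpen h.isOpen (by norm_cast)).clm_apply contDiffOn_const

theorem contDiffOn_christoffel (h : IsMetricOn G U) (k i j : Fin n) :
    ContDiffOn ℝ ∞ (fun x => christoffel G x k i j) U :=
  contDiffOn_const.mul (ContDiffOn.sum fun l _ => (h.contDiffOn_inv k l).mul
    (((h.contDiffOn_pd i j l).add (h.contDiffOn_pd j i l)).sub (h.contDiffOn_pd l i j)))

theorem contDiffOn_smul_vec {F : Type*} [NormedAddCommGroup F] [NormedSpace ℝ F]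
    {f : Coord n → ℝ} (hf : ContDiffOn ℝ ∞ f U) (w : F) : ContDiffOn ℝ ∞ (fun x => f x • w) U :=
  hf.smul contDiffOn_const

theorem contDiffOn_metricForm (h : IsMetricOn G U) : ContDiffOn ℝ ∞ (metricForm G) U := by
  unfold metricForm
  exact ContDiffOn.sum fun i _ => ContDiffOn.sum fun j _ => contDiffOn_smul_vec (h.contDiffOn i j) _

theorem contDiffOn_connectionForm (h : IsMetricOn G U) : ContDiffOn ℝ ∞ (connectionForm G) U := by
  unfold connectionForm
  exact ContDiffOn.sum fun k _ => ContDiffOn.sum fun i _ => ContDiffOn.sum fun j _ =>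
    contDiffOn_smul_vec (h.contDiffOn_christoffel k i j) _

theorem pd_symm (h : IsMetricOn G U) (hx : x ∈ U) (k i j : Fin n) :
    pd k (fun y => G y i j) x = pd k (fun y => G y j i) x := by
  have : (fun y => G y i j) =ᶠ[𝓝 x] fun y => G y j i := by
    filter_upwards [h.isOpen.mem_nhds hx] with y hy using h.symm y hy i j
  rw [pd, this.fderiv_eq, pd]

/-- Lowering the index of the Christoffel symbols. -/
theorem sum_christoffel_mul (h : IsMetricOn G U) (hx : x ∈ U) (m i j : Fin n) :
    ∑ k, christoffel G x k m i * G x k j = (1 / 2) * (pd m (fun y => G y i j) x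
      + pd i (fun y => G y m j) x - pd j (fun y => G y m i) x) := by
  set d : Fin n → ℝ := fun l => pd m (fun y => G y i l) x
      + pd i (fun y => G y m l) x - pd l (fun y => G y m i) x with hd
  have hinv : G x * (G x)⁻¹ = 1 := Matrix.mul_nonsing_inv _ (h.det_ne_zero hx).isUnit
  have hjl : ∀ l, ∑ k, G x j k * (G x)⁻¹ k l = if j = l then 1 else 0 := fun l => by
    rw [← Matrix.mul_apply, hinv, Matrix.one_apply]
  calc ∑ k, christoffel G x k m i * G x k j
      = ∑ k, ∑ l, (1 / 2) * (G x j k * (G x)⁻¹ k l * d l) := by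
        refine Finset.sum_congr rfl fun k _ => ?_
        rw [christoffel, ← Finset.mul_sum, mul_assoc, Finset.sum_mul, h.symm x hx k j]
        congr 1
        exact Finset.sum_congr rfl fun l _ => by ring
    _ = ∑ l, (1 / 2) * ((∑ k, G x j k * (G x)⁻¹ k l) * d l) := by
        rw [Finset.sum_comm]
        refine Finset.sum_congr rfl fun l _ => ?_
        rw [Finset.sum_mul, Finset.mul_sum]
    _ = (1 / 2) * d j := by simp [hjl]

theorem fderiv_metricForm_stdVec (h : IsMetricOn G U) (hx : x ∈ U) (m i j : Fin n) :
    fderiv ℝ (metricForm G) x (stdVec m) (stdVec i) (stdVec j) = pd m (fun y => G y i j) x := by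
  have hB := ((h.contDiffOn_metricForm.contDiffAt (h.isOpen.mem_nhds hx)).differentiableAt
    (by simp)).hasFDerivAt
  have := ((hB.clm_apply (hasFDerivAt_const (stdVec i) x)).clm_apply
    (hasFDerivAt_const (stdVec j) x)).fderiv
  simp only [metricForm_stdVec] at this
  rw [pd, this]
  simp

theorem metricForm_connectionForm_stdVec (m i j : Fin n) :
    metricForm G x (connectionForm G x (stdVec m) (stdVec i)) (stdVec j)
      = ∑ k, christoffel G x k m i * G x k j := by
  rw [metricForm_apply]
  simp only [connectionForm_stdVec]
  simp [stdVec_apply, mul_comm]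

/-- The Christoffel symbols define the Levi-Civita connection. -/
theorem isLeviCivitaOn (h : IsMetricOn G U) :
    IsLeviCivitaOn (metricForm G) (connectionForm G) U where
  isOpen := h.isOpen
  contDiffOn_metric := h.contDiffOn_metricForm
  contDiffOn_connection := h.contDiffOn_connectionForm
  symm x hx u v := by
    rw [metricForm_apply, metricForm_apply, Finset.sum_comm]
    refine Finset.sum_congr rfl fun i _ => Finset.sum_congr rfl fun j _ => ?_
    rw [h.symm x hx]; ring
  pos := h.pos
  torsionFree x hx u v := by
    rw [connectionForm_apply, connectionForm_apply]
    ext k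
    simp only [christoffelVec]
    rw [Finset.sum_comm]
    refine Finset.sum_congr rfl fun i _ => Finset.sum_congr rfl fun j _ => ?_
    have : christoffel G x k j i = christoffel G x k i j := by
      simp only [christoffel]
      congr 1
      refine Finset.sum_congr rfl fun l _ => ?_
      rw [h.pd_symm hx l j i]; ring
    rw [this]; ring
  compat x hx z u v := by
    have hsymm : ∀ i (w : Coord n), metricForm G x (stdVec i) w = metricForm G x w (stdVec i) := by
      intro i w
      rw [metricForm_apply, metricForm_apply, Finset.sum_comm]
      refine Finset.sum_congr rfl fun i _ => Finset.sum_congr rfl fun j _ => ?_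
      rw [h.symm x hx]; ring
    have key : ∀ m i j, fderiv ℝ (metricForm G) x (stdVec m) (stdVec i) (stdVec j)
        = metricForm G x (connectionForm G x (stdVec m) (stdVec i)) (stdVec j)
          + metricForm G x (stdVec i) (connectionForm G x (stdVec m) (stdVec j)) := by
      intro m i j
      rw [hsymm i, metricForm_connectionForm_stdVec, metricForm_connectionForm_stdVec,
        h.sum_christoffel_mul hx, h.sum_christoffel_mul hx, h.fderiv_metricForm_stdVec hx,
        h.pd_symm hx m j i]
      ring
    have key2 : ∀ m i, fderiv ℝ (metricForm G) x (stdVec m) (stdVec i) v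
        = metricForm G x (connectionForm G x (stdVec m) (stdVec i)) v
          + metricForm G x (stdVec i) (connectionForm G x (stdVec m) v) := by
      intro m i
      rw [← sum_smul_stdVec v]
      simp only [map_sum, map_smul, key, smul_add, Finset.sum_add_distrib]
    have key3 : ∀ m, fderiv ℝ (metricForm G) x (stdVec m) u v
        = metricForm G x (connectionForm G x (stdVec m) u) v
          + metricForm G x u (connectionForm G x (stdVec m) v) := by
      intro m
      rw [← sum_smul_stdVec u]
      simp only [map_sum, map_smul, sum_apply, smul_apply, key2, smul_add,
        Finset.sum_add_distrib]
    rw [← sum_smul_stdVec z]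
    simp only [map_sum, map_smul, sum_apply, smul_apply, key3, smul_add,
        Finset.sum_add_distrib]

theorem fderiv_connectionForm_stdVec (h : IsMetricOn G U) (hx : x ∈ U) (i j k l : Fin n) :
    fderiv ℝ (connectionForm G) x (stdVec i) (stdVec j) (stdVec k) l
      = pd i (fun y => christoffel G y l j k) x := by
  have hΓ := h.isLeviCivitaOn.hasFDerivAt_connection hx
  have hcomp : (fun y => christoffel G y l j k) = (EuclideanSpace.proj l : Coord n →L[ℝ] ℝ) ∘
      fun y => connectionForm G y (stdVec j) (stdVec k) := by
    funext y
    exact (connectionForm_stdVec j k l).symm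
  rw [pd, hcomp, ((EuclideanSpace.proj l : Coord n →L[ℝ] ℝ).hasFDerivAt.comp x
    ((hΓ.clm_apply (hasFDerivAt_const (stdVec j) x)).clm_apply
    (hasFDerivAt_const (stdVec k) x))).fderiv]
  simp

theorem formCurvature_stdVec (h : IsMetricOn G U) (hx : x ∈ U) (i j k l : Fin n) :
    formCurvature (connectionForm G) x (stdVec i) (stdVec j) (stdVec k) l
      = curvatureCoeff G x l i j k := by
  have key : ∀ i (w : Coord n), connectionForm G x (stdVec i) w l
      = ∑ m, christoffel G x l i m * w m := by
    intro i w
    conv_lhs => rw [← sum_smul_stdVec w]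
    simp [connectionForm_stdVec, mul_comm]
  simp only [formCurvature, PiLp.add_apply, PiLp.sub_apply, h.fderiv_connectionForm_stdVec hx, key,
    connectionForm_stdVec, curvatureCoeff, Finset.sum_sub_distrib]
  ring

/-- The coordinate curvature is the curvature of the connection form. -/
theorem formCurvature_eq (h : IsMetricOn G U) (hx : x ∈ U) (u v w : Coord n) :
    formCurvature (connectionForm G) x u v w = curvatureVec G x u v w := by
  have key : ∀ u v w : Coord n, formCurvature (connectionForm G) x u v w
      = ∑ k, w k • formCurvature (connectionForm G) x u v (stdVec k) := fun u v w => by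
    conv_lhs => rw [← sum_smul_stdVec w]
    simp only [formCurvature, map_sum, map_smul, smul_add, smul_sub, Finset.sum_add_distrib,
      Finset.sum_sub_distrib]
  have key2 : ∀ u v w : Coord n, formCurvature (connectionForm G) x u v w
      = ∑ j, v j • formCurvature (connectionForm G) x u (stdVec j) w := fun u v w => by
    conv_lhs => rw [← sum_smul_stdVec v]
    simp only [formCurvature, map_sum, map_smul, sum_apply, smul_apply, smul_add, smul_sub,
      Finset.sum_add_distrib, Finset.sum_sub_distrib]
  have key3 : ∀ u v w : Coord n, formCurvature (connectionForm G) x u v w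
      = ∑ i, u i • formCurvature (connectionForm G) x (stdVec i) v w := fun u v w => by
    conv_lhs => rw [← sum_smul_stdVec u]
    simp only [formCurvature, map_sum, map_smul, sum_apply, smul_apply, smul_add, smul_sub,
      Finset.sum_add_distrib, Finset.sum_sub_distrib]
  have hlin : formCurvature (connectionForm G) x u v w = ∑ i, ∑ j, ∑ k,
      (u i * v j * w k) • formCurvature (connectionForm G) x (stdVec i) (stdVec j) (stdVec k) := by
    rw [key3]
    refine Finset.sum_congr rfl fun i _ => ?_
    rw [key2, Finset.smul_sum]
    refine Finset.sum_congr rfl fun j _ => ?_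
    rw [key, Finset.smul_sum, Finset.smul_sum]
    simp only [smul_smul, mul_assoc]
  ext l
  rw [hlin]
  simp only [curvatureVec, WithLp.ofLp_sum, Finset.sum_apply, PiLp.smul_apply, smul_eq_mul,
    h.formCurvature_stdVec hx]
  refine Finset.sum_congr rfl fun i _ => Finset.sum_congr rfl fun j _ =>
    Finset.sum_congr rfl fun k _ => ?_
  ring

end IsMetricOn

end Coordinates

/-! ### The Euler-Lagrange equations of the Lagrangian -/

section Lagrangian

variable {n : ℕ} {G : Coord n → Matrix (Fin n) (Fin n) ℝ} {U : Set (Coord n)}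
  {p : ℝ} {x v a : Coord n}

theorem lagrangian_eq : lagrangian G p x v a =
    (metricForm G x (a + connectionForm G x v v) (a + connectionForm G x v v)) ^ (p / 2) := by
  rw [lagrangian, metricForm_apply, connectionForm_apply]

variable (G p) in
/-- The vector `|τ|^{p-2} τ` at `x`. -/
def pPower (x τ : Coord n) : Coord n := √(metricForm G x τ τ) ^ (p - 2) • τ

/-- The condition under which `B(τ, τ)^{p/2}` can be differentiated by the chain rule: either the
base does not vanish, or the exponent `p / 2` is at least `1`. -/
def AdmissibleTension (p : ℝ) (τ : Coord n) : Prop := τ ≠ 0 ∨ 2 ≤ p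

namespace IsMetricOn

theorem metricForm_nonneg (h : IsMetricOn G U) (hx : x ∈ U) (τ : Coord n) :
    0 ≤ metricForm G x τ τ := by
  by_cases hτ : τ = 0
  · simp [hτ]
  · exact (h.pos x hx τ hτ).le

theorem metricForm_pPower (h : IsMetricOn G U) (hx : x ∈ U) (τ w : Coord n) :
    metricForm G x (pPower G p x τ) w = (metricForm G x τ τ) ^ (p / 2 - 1) * metricForm G x τ w := by
  rw [pPower, map_smul, smul_apply, smul_eq_mul, Real.sqrt_eq_rpow,
    ← Real.rpow_mul (h.metricForm_nonneg hx τ)]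
  ring_nf

/-- The derivative of `B(τ, τ)^{p/2}` for a family of vectors `τ` at the points `b`. Varying the
acceleration, the velocity or the position gives the three partial derivatives of the
Lagrangian. -/
theorem fderiv_rpow_apply (h : IsMetricOn G U) {F : Type*} [NormedAddCommGroup F] [NormedSpace ℝ F]
    {b τ : F → Coord n} {b' τ' : F →L[ℝ] Coord n} {y : F} (hy : b y ∈ U) (hb : HasFDerivAt b b' y)
    (hτ : HasFDerivAt τ τ' y) (hp : AdmissibleTension p (τ y)) (e : F) :
    fderiv ℝ (fun y => (metricForm G (b y) (τ y) (τ y)) ^ (p / 2)) y e =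
      p * (1 / 2 * fderiv ℝ (metricForm G) (b y) (b' e) (pPower G p (b y) (τ y)) (τ y)
        + metricForm G (b y) (pPower G p (b y) (τ y)) (τ' e)) := by
  have hB : HasFDerivAt (fun y => metricForm G (b y)) (fderiv ℝ (metricForm G) (b y) ∘L b') y :=
    HasFDerivAt.comp (g := metricForm G) y (h.isLeviCivitaOn.hasFDerivAt_metric hy) hb
  have h1 := (hB.clm_apply hτ).clm_apply hτ
  have hne : metricForm G (b y) (τ y) (τ y) ≠ 0 ∨ 1 ≤ p / 2 := by
    rcases hp with hp | hp
    · exact Or.inl (h.pos _ hy _ hp).ne'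
    · exact Or.inr (by linarith)
  rw [(h1.rpow_const hne).fderiv, h.metricForm_pPower hy]
  have h2 : fderiv ℝ (metricForm G) (b y) (b' e) (pPower G p (b y) (τ y)) (τ y)
      = (metricForm G (b y) (τ y) (τ y)) ^ (p / 2 - 1)
        * fderiv ℝ (metricForm G) (b y) (b' e) (τ y) (τ y) := by
    rw [pPower, map_smul, smul_apply, smul_eq_mul, Real.sqrt_eq_rpow,
      ← Real.rpow_mul (h.metricForm_nonneg hy _)]
    ring_nf
  rw [h2]
  simp
  rw [h.isLeviCivitaOn.symm _ hy (τ' e) (τ y)]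
  ring

theorem pd_lagrangian_acc (h : IsMetricOn G U) (hx : x ∈ U)
    (hp : AdmissibleTension p (a + connectionForm G x v v)) (k : Fin n) :
    pd k (fun a => lagrangian G p x v a) a
      = p * metricForm G x (pPower G p x (a + connectionForm G x v v)) (stdVec k) := by
  have h1 : HasFDerivAt (fun a => a + connectionForm G x v v) (ContinuousLinearMap.id ℝ (Coord n))
    a := (hasFDerivAt_id a).add_const _
  simp only [pd, lagrangian_eq]
  rw [h.fderiv_rpow_apply (b := fun _ => x) hx (hasFDerivAt_const x a) h1 hp]
  simp

theorem pd_lagrangian_vel (h : IsMetricOn G U) (hx : x ∈ U)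
    (hp : AdmissibleTension p (a + connectionForm G x v v)) (k : Fin n) :
    pd k (fun v => lagrangian G p x v a) v
      = 2 * p * metricForm G x (pPower G p x (a + connectionForm G x v v))
          (connectionForm G x (stdVec k) v) := by
  have hid : HasFDerivAt (fun v : Coord n => v) (ContinuousLinearMap.id ℝ (Coord n)) v :=
    hasFDerivAt_id v
  have h1 := (((hasFDerivAt_const (connectionForm G x) v).clm_apply hid).clm_apply hid).const_add a
  simp only [pd, lagrangian_eq]
  rw [h.fderiv_rpow_apply (b := fun _ => x) hx (hasFDerivAt_const x v) h1 hp]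
  simp
  rw [h.isLeviCivitaOn.torsionFree x hx v (stdVec k)]
  ring

theorem pd_lagrangian_pos (h : IsMetricOn G U) (hx : x ∈ U)
    (hp : AdmissibleTension p (a + connectionForm G x v v)) (k : Fin n) :
    pd k (fun x => lagrangian G p x v a) x
      = p * (1 / 2 * fderiv ℝ (metricForm G) x (stdVec k)
            (pPower G p x (a + connectionForm G x v v)) (a + connectionForm G x v v)
          + metricForm G x (pPower G p x (a + connectionForm G x v v))
            (fderiv ℝ (connectionForm G) x (stdVec k) v v)) := by
  have h1 := (((h.isLeviCivitaOn.hasFDerivAt_connection hx).clm_apply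
    (hasFDerivAt_const v x)).clm_apply (hasFDerivAt_const v x)).const_add a
  simp only [pd, lagrangian_eq]
  rw [h.fderiv_rpow_apply (b := fun x => x) hx (hasFDerivAt_id x) h1 hp]
  simp

end IsMetricOn

theorem differentiableWithinAt_const_mul_iff {f : ℝ → ℝ} {r : ℝ} (hr : r ≠ 0) {I : Set ℝ} {t : ℝ} :
    DifferentiableWithinAt ℝ (fun t => r * f t) I t ↔ DifferentiableWithinAt ℝ f I t :=
  ⟨fun h => by simpa [hr] using h.const_mul r⁻¹, fun h => h.const_mul r⟩

variable (G) in
/-- The tension `c'' + Γ(c', c')` of a coordinate curve. -/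
def coordTension (I : Set ℝ) (c : ℝ → Coord n) (t : ℝ) : Coord n :=
  formCovDeriv (connectionForm G) I c (derivWithin c I) t

variable (G p) in
/-- The field `|τ|^{p-2} τ` for the tension `τ` of a coordinate curve. -/
def coordPTension (I : Set ℝ) (c : ℝ → Coord n) (t : ℝ) : Coord n :=
  pPower G p (c t) (coordTension G I c t)

variable (G p) in
/-- The equation for `p`-biharmonic curves in coordinates, including the existence of the
derivatives in it. -/
structure CoordPBiharmonicAt (I : Set ℝ) (c : ℝ → Coord n) (s : ℝ) : Prop where
  diff : ∀ᶠ t in 𝓝[I] s, DifferentiableWithinAt ℝ (coordPTension G p I c) I t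
  diff_covDeriv :
    DifferentiableWithinAt ℝ (formCovDeriv (connectionForm G) I c (coordPTension G p I c)) I s
  equation : formCovDeriv (connectionForm G) I c
      (formCovDeriv (connectionForm G) I c (coordPTension G p I c)) s
    - √(metricForm G (c s) (coordTension G I c s) (coordTension G I c s)) ^ (p - 2) •
      curvatureVec G (c s) (derivWithin c I s) (coordTension G I c s) (derivWithin c I s) = 0

variable {I : Set ℝ} {c : ℝ → Coord n} {s t : ℝ}

namespace IsMetricOn

theorem dLagAcc_eq (h : IsMetricOn G U) (ht : c t ∈ U)
    (hp : AdmissibleTension p (coordTension G I c t)) (k : Fin n) :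
    dLagAcc G p I c k t = p * metricForm G (c t) (coordPTension G p I c t) (stdVec k) :=
  h.pd_lagrangian_acc ht hp k

theorem dLagVel_eq (h : IsMetricOn G U) (ht : c t ∈ U)
    (hp : AdmissibleTension p (coordTension G I c t)) (k : Fin n) :
    dLagVel G p I c k t = 2 * p * metricForm G (c t) (coordPTension G p I c t)
      (connectionForm G (c t) (stdVec k) (derivWithin c I t)) :=
  h.pd_lagrangian_vel ht hp k

theorem dLagPos_eq (h : IsMetricOn G U) (ht : c t ∈ U)
    (hp : AdmissibleTension p (coordTension G I c t)) (k : Fin n) :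
    dLagPos G p I c k t = p * (1 / 2 * fderiv ℝ (metricForm G) (c t) (stdVec k)
            (coordPTension G p I c t) (coordTension G I c t)
          + metricForm G (c t) (coordPTension G p I c t)
            (fderiv ℝ (connectionForm G) (c t) (stdVec k) (derivWithin c I t)
              (derivWithin c I t))) :=
  h.pd_lagrangian_pos ht hp k

/-- In a single chart, the equation for `p`-biharmonic curves is equivalent to the system of
Euler-Lagrange equations. -/
theorem coordPBiharmonicAt_iff (h : IsMetricOn G U) (hp0 : p ≠ 0) (hI : UniqueDiffOn ℝ I)
    (hs : s ∈ I) (hc : TwiceDiffNear U I c s)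
    (hp : ∀ᶠ t in 𝓝[I] s, AdmissibleTension p (coordTension G I c t)) :
    CoordPBiharmonicAt G p I c s ↔ ∀ k, EulerLagrangeAt G p I c k s := by
  have hL := h.isLeviCivitaOn
  set W := coordPTension G p I c with hWdef
  have hsU := (hc.self_of_nhdsWithin hs).1
  have hacc : ∀ k, ∀ᶠ t in 𝓝[I] s, dLagAcc G p I c k t
      = p * metricForm G (c t) (W t) (stdVec k) := fun k => by
    filter_upwards [hc, hp] with t ht hpt using h.dLagAcc_eq ht.1 hpt k
  -- the same identity holds near every nearby parameter, hence for the derivatives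
  have hacc' : ∀ k, ∀ᶠ t in 𝓝[I] s, dLagAcc G p I c k
      =ᶠ[𝓝[I] t] fun t => p * metricForm G (c t) (W t) (stdVec k) := fun k =>
    eventually_eventually_nhdsWithin.2 (hacc k)
  have hdacc : ∀ k, derivWithin (dLagAcc G p I c k) I
      =ᶠ[𝓝[I] s] fun t => p * derivWithin (fun t => metricForm G (c t) (W t) (stdVec k)) I t :=
    fun k => by
      filter_upwards [hacc' k, self_mem_nhdsWithin] with t ht htI
      rw [ht.derivWithin_eq (ht.self_of_nhdsWithin htI), derivWithin_const_mul_field]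
  have hdiff : ∀ k, (∀ᶠ t in 𝓝[I] s, DifferentiableWithinAt ℝ (dLagAcc G p I c k) I t) ↔
      ∀ᶠ t in 𝓝[I] s, DifferentiableWithinAt ℝ
        (fun t => metricForm G (c t) (W t) (stdVec k)) I t := fun k => by
    refine Filter.eventually_congr ?_
    filter_upwards [hacc' k, self_mem_nhdsWithin] with t ht htI
    rw [ht.differentiableWithinAt_iff_of_mem htI]
    exact differentiableWithinAt_const_mul_iff hp0
  have hdiff2 : ∀ k, DifferentiableWithinAt ℝ (derivWithin (dLagAcc G p I c k) I) I s ↔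
      DifferentiableWithinAt ℝ
        (derivWithin (fun t => metricForm G (c t) (W t) (stdVec k)) I) I s := fun k => by
    rw [(hdacc k).differentiableWithinAt_iff_of_mem hs]
    exact differentiableWithinAt_const_mul_iff hp0
  have hvel : ∀ k, dLagVel G p I c k =ᶠ[𝓝[I] s] fun t => 2 * p * metricForm G (c t) (W t)
      (connectionForm G (c t) (stdVec k) (derivWithin c I t)) := fun k => by
    filter_upwards [hc, hp] with t ht hpt using h.dLagVel_eq ht.1 hpt k
  -- differentiability of `∂L/∂γ'` is no extra condition, since it only involves `W` itself
  have hdvel : ∀ k, (∀ᶠ t in 𝓝[I] s, DifferentiableWithinAt ℝ W I t) →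
      DifferentiableWithinAt ℝ (dLagVel G p I c k) I s := fun k hW => by
    obtain ⟨_, hcs, hvs⟩ := hc.self_of_nhdsWithin hs
    rw [(hvel k).differentiableWithinAt_iff_of_mem hs]
    exact (hL.hasDerivWithinAt_metric_connection hsU hcs hvs (hW.self_of_nhdsWithin hs)
      (stdVec k)).differentiableWithinAt.const_mul _
  have hexpr : ∀ k, (∀ᶠ t in 𝓝[I] s, DifferentiableWithinAt ℝ W I t) →
      DifferentiableWithinAt ℝ (formCovDeriv (connectionForm G) I c W) I s →
      derivWithin (derivWithin (dLagAcc G p I c k) I) I s - derivWithin (dLagVel G p I c k) I s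
        + dLagPos G p I c k s
      = p * metricForm G (c s) (formCovDeriv (connectionForm G) I c
          (formCovDeriv (connectionForm G) I c W) s
        - √(metricForm G (c s) (coordTension G I c s) (coordTension G I c s)) ^ (p - 2) •
          curvatureVec G (c s) (derivWithin c I s) (coordTension G I c s) (derivWithin c I s))
          (stdVec k) := fun k hW hDW => by
    rw [(hdacc k).derivWithin_eq ((hdacc k).self_of_nhdsWithin hs),
      (hvel k).derivWithin_eq ((hvel k).self_of_nhdsWithin hs), derivWithin_const_mul_field,
      derivWithin_const_mul_field, h.dLagPos_eq hsU (hp.self_of_nhdsWithin hs),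
      ← h.formCurvature_eq hsU, ← hL.eulerLagrange_eq hI hs hc hW hDW (τ := coordTension G I c s)
        rfl rfl (stdVec k)]
    ring
  let b := (EuclideanSpace.basisFun (Fin n) ℝ).toBasis
  have hb : ∀ k, b k = stdVec k := fun k => by simp [b, stdVec]
  constructor
  · rintro ⟨h1, h2, h3⟩ k
    refine ⟨(hdiff k).2 ?_, (hdiff2 k).2 ?_, hdvel k h1, ?_⟩
    · filter_upwards [hc, h1] with t ht hWt
      exact (hL.hasDerivWithinAt_metric_const ht.1 ht.2.1 hWt _).differentiableWithinAt
    · rw [hL.differentiableWithinAt_derivWithin_metric_iff hI hs hc h1]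
      exact (hL.hasDerivWithinAt_metric_const hsU (hc.self_of_nhdsWithin hs).2.1 h2
        _).differentiableWithinAt
    · rw [hexpr k h1 h2, h3]
      simp
  · intro hEL
    have h1 : ∀ᶠ t in 𝓝[I] s, DifferentiableWithinAt ℝ W I t := by
      have hall := Filter.eventually_all.2 fun k => (hdiff k).1 (hEL k).diff_acc
      filter_upwards [hc, hall, self_mem_nhdsWithin] with t ht hWt htI
      exact hL.differentiableWithinAt_of_metric b htI ht.1 ht.2.1 fun k => by
        simpa only [hb] using hWt k
    have h2 : DifferentiableWithinAt ℝ (formCovDeriv (connectionForm G) I c W) I s :=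
      hL.differentiableWithinAt_of_metric b hs hsU (hc.self_of_nhdsWithin hs).2.1 fun k => by
        rw [hb, ← hL.differentiableWithinAt_derivWithin_metric_iff hI hs hc h1]
        exact (hdiff2 k).1 (hEL k).diff_deriv_acc
    refine ⟨h1, h2, hL.eq_zero_of_forall hsU fun w => ?_⟩
    rw [map_eq_sum]
    refine Finset.sum_eq_zero fun k _ => ?_
    have := (hEL k).equation
    rw [hexpr k h1 h2] at this
    rw [(mul_eq_zero.1 this).resolve_left hp0, smul_zero]

end IsMetricOn

end Lagrangian

/-! ### Tangent vectors and the metric in charts -/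

section Charts

variable {n : ℕ} {M : Type*} [TopologicalSpace M] {φ ψ : OpenPartialHomeomorph M (Coord n)}

theorem mem_trans_source {q : M} (hφ : q ∈ φ.source) (hψ : q ∈ ψ.source) :
    φ q ∈ (φ.symm ≫ₕ ψ).source := by
  simp [hφ, hψ]

theorem trans_source_subset : (φ.symm ≫ₕ ψ).source ⊆ φ.target := fun x hx => by
  simp at hx; exact hx.1

theorem mapsTo_trans : Set.MapsTo (ψ ∘ φ.symm) (φ.symm ≫ₕ ψ).source ψ.target := fun x hx => by
  simp at hx; exact ψ.map_source hx.2

variable [ChartedSpace (Coord n) M]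

theorem mdifferentiable_of_mem_maximalAtlas (hφ : φ ∈ IsManifold.maximalAtlas (𝓡 n) ∞ M) :
    φ.MDifferentiable (𝓡 n) (𝓡 n) :=
  ⟨(contMDiffOn_of_mem_maximalAtlas hφ).mdifferentiableOn (by simp),
    (contMDiffOn_symm_of_mem_maximalAtlas hφ).mdifferentiableOn (by simp)⟩

theorem vecIn_sub (q : M) (v w : TangentSpace (𝓡 n) q) :
    vecIn φ q (v - w) = vecIn φ q v - vecIn φ q w := map_sub (mfderiv (𝓡 n) (𝓡 n) φ q) v w

theorem vecIn_smul (q : M) (r : ℝ) (v : TangentSpace (𝓡 n) q) :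
    vecIn φ q (r • v) = r • vecIn φ q v := map_smul (mfderiv (𝓡 n) (𝓡 n) φ q) r v

theorem contDiffOn_trans (hφ : φ ∈ IsManifold.maximalAtlas (𝓡 n) ∞ M)
    (hψ : ψ ∈ IsManifold.maximalAtlas (𝓡 n) ∞ M) :
    ContDiffOn ℝ ∞ (ψ ∘ φ.symm) (φ.symm ≫ₕ ψ).source := by
  rw [← contMDiffOn_iff_contDiffOn]
  refine (contMDiffOn_of_mem_maximalAtlas hψ).comp
    ((contMDiffOn_symm_of_mem_maximalAtlas hφ).mono fun x hx => ?_) fun x hx => ?_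
  · simp at hx; exact hx.1
  · simp at hx; exact hx.2

theorem vecIn_mfderiv_symm (hφ : φ ∈ IsManifold.maximalAtlas (𝓡 n) ∞ M) {x : Coord n}
    (hx : x ∈ φ.target) (u : Coord n) :
    vecIn φ (φ.symm x) (mfderiv (𝓡 n) (𝓡 n) φ.symm x u) = u :=
  DFunLike.congr_fun ((mdifferentiable_of_mem_maximalAtlas hφ).comp_symm_deriv hx) u

theorem mfderiv_symm_vecIn (hφ : φ ∈ IsManifold.maximalAtlas (𝓡 n) ∞ M) {q : M}
    (hq : q ∈ φ.source) (v : TangentSpace (𝓡 n) q) :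
    (mfderiv (𝓡 n) (𝓡 n) φ.symm (φ q) (vecIn φ q v) : Coord n) = v :=
  DFunLike.congr_fun ((mdifferentiable_of_mem_maximalAtlas hφ).symm_comp_deriv hq) v

theorem vecIn_eq_zero_iff (hφ : φ ∈ IsManifold.maximalAtlas (𝓡 n) ∞ M) {q : M}
    (hq : q ∈ φ.source) (v : TangentSpace (𝓡 n) q) : vecIn φ q v = 0 ↔ v = 0 := by
  constructor
  · intro h
    have := mfderiv_symm_vecIn hφ hq v
    rw [h] at this
    rw [← this]
    exact map_zero _
  · rintro rfl
    exact map_zero (mfderiv (𝓡 n) (𝓡 n) φ q)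

/-- The derivative of the change of charts maps coordinates of vectors to coordinates. -/
theorem fderiv_trans_apply (hφ : φ ∈ IsManifold.maximalAtlas (𝓡 n) ∞ M)
    (hψ : ψ ∈ IsManifold.maximalAtlas (𝓡 n) ∞ M) {x : Coord n} (hx : x ∈ (φ.symm ≫ₕ ψ).source)
    (u : Coord n) :
    fderiv ℝ (ψ ∘ φ.symm) x u = vecIn ψ (φ.symm x) (mfderiv (𝓡 n) (𝓡 n) φ.symm x u) := by
  simp at hx
  rw [← mfderiv_eq_fderiv, mfderiv_comp x
    ((mdifferentiable_of_mem_maximalAtlas hψ).mdifferentiableAt hx.2)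
    ((mdifferentiable_of_mem_maximalAtlas hφ).mdifferentiableAt_symm hx.1)]
  rfl

theorem vecIn_change (hφ : φ ∈ IsManifold.maximalAtlas (𝓡 n) ∞ M)
    (hψ : ψ ∈ IsManifold.maximalAtlas (𝓡 n) ∞ M) {q : M} (hq : q ∈ φ.source) (hq' : q ∈ ψ.source)
    (v : TangentSpace (𝓡 n) q) :
    fderiv ℝ (ψ ∘ φ.symm) (φ q) (vecIn φ q v) = vecIn ψ q v := by
  rw [fderiv_trans_apply hφ hψ (mem_trans_source hq hq')]
  -- replaces the base point `φ.symm (φ q)` by `q` in the dependent type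
  have h : ∀ q' : M, q' = q → ∀ w : Coord n, vecIn ψ q' w = vecIn ψ q w := by
    rintro _ rfl _; rfl
  exact (h _ (φ.left_inv hq) _).trans (congrArg (vecIn ψ q) (mfderiv_symm_vecIn hφ hq v))

variable [IsManifold (𝓡 n) ∞ M] {g : Metric n M}

theorem vecIn_ofCoord (q : M) (w : Coord n) : vecIn (chartAt (Coord n) q) q (ofCoord q w) = w := by
  have h := mdifferentiable_of_mem_maximalAtlas
    (IsManifold.chart_mem_maximalAtlas (I := 𝓡 n) (n := ∞) q)
  have e : mfderiv (𝓡 n) (𝓡 n) (chartAt (Coord n) q) q = h.mfderiv (mem_chart_source _ q) := rfl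
  rw [vecIn, ofCoord, e, ContinuousLinearMap.inverse_equiv]
  exact (h.mfderiv (mem_chart_source _ q)).apply_symm_apply w

theorem metricForm_metricIn (x u w : Coord n) : metricForm (metricIn g φ) x u w =
    g.inner (φ.symm x) (mfderiv (𝓡 n) (𝓡 n) φ.symm x u) (mfderiv (𝓡 n) (𝓡 n) φ.symm x w) := by
  have h : ∀ (b : Coord n →L[ℝ] Coord n →L[ℝ] ℝ) (L : Coord n →L[ℝ] Coord n),
      (∀ i j, metricIn g φ x i j = b (L (stdVec i)) (L (stdVec j))) →
      metricForm (metricIn g φ) x u w = b (L u) (L w) := fun b L hbL => by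
    rw [metricForm_apply, map_eq_sum L u, map_sum, sum_apply]
    refine Finset.sum_congr rfl fun i _ => ?_
    rw [map_smul, smul_apply, map_eq_sum L w, map_sum, Finset.smul_sum]
    refine Finset.sum_congr rfl fun j _ => ?_
    rw [map_smul, hbL, smul_eq_mul, smul_eq_mul]
    ring
  exact h (g.inner (φ.symm x)) (mfderiv (𝓡 n) (𝓡 n) φ.symm x) fun _ _ => rfl

theorem inner_eq_metricForm (hφ : φ ∈ IsManifold.maximalAtlas (𝓡 n) ∞ M) {q : M}
    (hq : q ∈ φ.source) (v w : TangentSpace (𝓡 n) q) :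
    g.inner q v w = metricForm (metricIn g φ) (φ q) (vecIn φ q v) (vecIn φ q w) := by
  rw [metricForm_metricIn]
  -- replaces the base point `φ.symm (φ q)` by `q` in the dependent type
  have h : ∀ q' : M, q' = q → ∀ v w : Coord n, g.inner q' v w = g.inner q v w := by
    rintro _ rfl _ _; rfl
  refine Eq.trans ?_ (h _ (φ.left_inv hq) _ _).symm
  exact congrArg₂ (fun a b : Coord n => g.inner q a b) (mfderiv_symm_vecIn hφ hq v).symm
    (mfderiv_symm_vecIn hφ hq w).symm

/-- Coordinates in the preferred chart at `q₀` are the fiber coordinates of the trivialization of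
the tangent bundle at `q₀`. -/
theorem trivializationAt_snd (q₀ : M) {q : M} (hq : q ∈ (chartAt (Coord n) q₀).source)
    (v : TangentSpace (𝓡 n) q) :
    (trivializationAt (Coord n) (TangentSpace (𝓡 n)) q₀ ⟨q, v⟩).2
      = vecIn (chartAt (Coord n) q₀) q v := by
  have h := DFunLike.congr_fun
    (TangentBundle.continuousLinearMapAt_trivializationAt (I := 𝓡 n) (x₀ := q₀) hq) v
  rw [Bundle.Trivialization.continuousLinearMapAt_apply,
    Bundle.Trivialization.linearMapAt_apply, if_pos (by simpa using hq)] at h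
  rw [h]
  rfl

/-- The coordinate vector fields of a chart are smooth. -/
theorem contMDiffAt_mfderiv_symm (hφ : φ ∈ IsManifold.maximalAtlas (𝓡 n) ∞ M) {x : Coord n}
    (hx : x ∈ φ.target) (u : Coord n) :
    ContMDiffAt (𝓡 n) (𝓡 n).tangent ∞ (fun x => (⟨φ.symm x, mfderiv (𝓡 n) (𝓡 n) φ.symm x u⟩ :
      TangentBundle (𝓡 n) M)) x := by
  have h1 : ContMDiffAt (𝓡 n) (𝓡 n) ∞ φ.symm x :=
    (contMDiffOn_symm_of_mem_maximalAtlas hφ).contMDiffAt (φ.open_target.mem_nhds hx)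
  rw [← contMDiffWithinAt_univ, Bundle.contMDiffWithinAt_totalSpace]
  refine ⟨h1.contMDiffWithinAt, ?_⟩
  rw [contMDiffWithinAt_univ, contMDiffAt_iff_contDiffAt]
  set ψ := chartAt (Coord n) (φ.symm x)
  have hψ : ψ ∈ IsManifold.maximalAtlas (𝓡 n) ∞ M := IsManifold.chart_mem_maximalAtlas _
  have hxs : x ∈ (φ.symm ≫ₕ ψ).source := by
    simp [hx, ψ]
  have hopen := (φ.symm ≫ₕ ψ).open_source.mem_nhds hxs
  have h2 : ContDiffAt ℝ ∞ (fun x => fderiv ℝ (ψ ∘ φ.symm) x u) x :=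
    (((contDiffOn_trans hφ hψ).contDiffAt hopen).fderiv_right (by norm_cast)).clm_apply
      contDiffAt_const
  refine h2.congr_of_eventuallyEq ?_
  filter_upwards [hopen] with y hy
  rw [fderiv_trans_apply hφ hψ hy]
  simp at hy
  exact trivializationAt_snd _ hy.2 _

/-- The components of a Riemannian metric in a chart form a metric on the target of the chart. -/
theorem isMetricOn (hφ : φ ∈ IsManifold.maximalAtlas (𝓡 n) ∞ M) :
    IsMetricOn (metricIn g φ) φ.target where
  isOpen := φ.open_target
  contDiffOn i j x hx := by
    refine ContDiffAt.contDiffWithinAt ?_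
    rw [← contMDiffAt_iff_contDiffAt]
    have h1 : ContMDiffAt (𝓡 n) (𝓡 n) ∞ φ.symm x :=
      (contMDiffOn_symm_of_mem_maximalAtlas hφ).contMDiffAt (φ.open_target.mem_nhds hx)
    have : ContMDiffAt (𝓡 n) ((𝓡 n).prod 𝓘(ℝ)) ∞
        (fun x => Bundle.TotalSpace.mk' ℝ (E := Bundle.Trivial M ℝ) (φ.symm x)
          (g.inner (φ.symm x) (mfderiv (𝓡 n) (𝓡 n) φ.symm x (stdVec i))
            (mfderiv (𝓡 n) (𝓡 n) φ.symm x (stdVec j)))) x := by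
      apply ContMDiffAt.clm_bundle_apply₂ (F₁ := Coord n) (F₂ := Coord n)
      · exact g.contMDiff.contMDiffAt.comp x h1
      · exact contMDiffAt_mfderiv_symm hφ hx _
      · exact contMDiffAt_mfderiv_symm hφ hx _
    rw [← contMDiffWithinAt_univ, Bundle.contMDiffWithinAt_totalSpace] at this
    exact this.2
  symm x _ i j := g.symm _ _ _
  pos x hx u hu := by
    rw [metricForm_metricIn]
    refine g.pos _ _ fun h => hu ?_
    rw [← vecIn_mfderiv_symm hφ hx u, h]
    exact map_zero (mfderiv (𝓡 n) (𝓡 n) φ (φ.symm x))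

/-- Changes of charts are isometries of the coordinate metrics. -/
theorem isIsometryOn_trans (hφ : φ ∈ IsManifold.maximalAtlas (𝓡 n) ∞ M)
    (hψ : ψ ∈ IsManifold.maximalAtlas (𝓡 n) ∞ M) :
    IsIsometryOn (metricForm (metricIn g φ)) (metricForm (metricIn g ψ)) (ψ ∘ φ.symm)
      (φ.symm ≫ₕ ψ).source where
  isOpen := (φ.symm ≫ₕ ψ).open_source
  contDiffOn := contDiffOn_trans hφ hψ
  surjective x hx w := by
    have hx' := hx
    simp at hx'
    refine ⟨vecIn φ (φ.symm x) (mfderiv (𝓡 n) (𝓡 n) ψ.symm (ψ (φ.symm x)) w), ?_⟩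
    have h := vecIn_change hφ hψ (φ.map_target hx'.1) hx'.2
      (mfderiv (𝓡 n) (𝓡 n) ψ.symm (ψ (φ.symm x)) w)
    rw [φ.right_inv hx'.1] at h
    rw [h]
    have h2 := vecIn_mfderiv_symm hψ (ψ.map_source hx'.2) w
    have h3 : ∀ q' : M, q' = φ.symm x → ∀ w : Coord n, vecIn ψ q' w = vecIn ψ (φ.symm x) w := by
      rintro _ rfl _; rfl
    exact (h3 _ (ψ.left_inv hx'.2) _).symm.trans h2
  metric_eq x hx u v := by
    rw [fderiv_trans_apply hφ hψ hx, fderiv_trans_apply hφ hψ hx, metricForm_metricIn]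
    simp at hx
    exact inner_eq_metricForm hψ hx.2 _ _

/-- The curvature in an arbitrary chart. -/
theorem vecIn_curvature (hφ : φ ∈ IsManifold.maximalAtlas (𝓡 n) ∞ M) {q : M} (hq : q ∈ φ.source)
    (u v w : TangentSpace (𝓡 n) q) : vecIn φ q (curvature g q u v w) =
      curvatureVec (metricIn g φ) (φ q) (vecIn φ q u) (vecIn φ q v) (vecIn φ q w) := by
  have hψ : chartAt (Coord n) q ∈ IsManifold.maximalAtlas (𝓡 n) ∞ M :=
    IsManifold.chart_mem_maximalAtlas _
  have hqψ := mem_chart_source (Coord n) q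
  have hf := isIsometryOn_trans (g := g) hψ hφ
  have key := hf.fderiv_curvature (isMetricOn hψ).isLeviCivitaOn (isMetricOn hφ).isLeviCivitaOn
    trans_source_subset mapsTo_trans (mem_trans_source hqψ hq) (vecIn (chartAt (Coord n) q) q u)
    (vecIn (chartAt (Coord n) q) q v) (vecIn (chartAt (Coord n) q) q w)
  simp only [vecIn_change hψ hφ hqψ hq] at key
  rw [(isMetricOn hψ).formCurvature_eq ((chartAt (Coord n) q).map_source hqψ),
    Function.comp_apply, (chartAt (Coord n) q).left_inv hqψ,
    (isMetricOn hφ).formCurvature_eq (φ.map_source hq)] at key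
  rw [← key, ← vecIn_change hψ hφ hqψ hq]
  congr 1
  exact vecIn_ofCoord q _

end Charts

/-! ### Vector fields along curves in charts -/

section Curves

variable {n : ℕ} {M : Type*} [TopologicalSpace M] {φ ψ : OpenPartialHomeomorph M (Coord n)}
  {γ : ℝ → M} {I : Set ℝ} {s t : ℝ}

theorem eventually_mem_source (hγ : ContinuousWithinAt γ I t) (ht : γ t ∈ φ.source) :
    ∀ᶠ r in 𝓝[I] t, γ r ∈ φ.source :=
  hγ.preimage_mem_nhdsWithin (φ.open_source.mem_nhds ht)

variable [ChartedSpace (Coord n) M] {V : (s : ℝ) → TangentSpace (𝓡 n) (γ s)}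

theorem vecIn_velocity (hφ : φ ∈ IsManifold.maximalAtlas (𝓡 n) ∞ M)
    (hI : UniqueDiffWithinAt ℝ I t) (hγ : MDifferentiableWithinAt 𝓘(ℝ) (𝓡 n) γ I t)
    (ht : γ t ∈ φ.source) :
    vecIn φ (γ t) (velocity γ I t) = derivWithin (fun t => φ (γ t)) I t := by
  have h := mfderiv_comp_mfderivWithin t
    ((mdifferentiable_of_mem_maximalAtlas hφ).mdifferentiableAt ht) hγ hI.uniqueMDiffWithinAt
  rw [mfderivWithin_eq_fderivWithin] at h
  exact (DFunLike.congr_fun h (1 : ℝ)).symm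

theorem eventually_vecIn_change (hφ : φ ∈ IsManifold.maximalAtlas (𝓡 n) ∞ M)
    (hψ : ψ ∈ IsManifold.maximalAtlas (𝓡 n) ∞ M) (hγ : ContinuousWithinAt γ I t)
    (ht : γ t ∈ φ.source) (ht' : γ t ∈ ψ.source) :
    (fun t => vecIn ψ (γ t) (V t)) =ᶠ[𝓝[I] t]
      fun t => fderiv ℝ (ψ ∘ φ.symm) (φ (γ t)) (vecIn φ (γ t) (V t)) := by
  filter_upwards [eventually_mem_source hγ ht, eventually_mem_source hγ ht'] with r hr hr'
  exact (vecIn_change hφ hψ hr hr' (V r)).symm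

theorem differentiableWithinAt_chart_comp (hφ : φ ∈ IsManifold.maximalAtlas (𝓡 n) ∞ M)
    (hγ : MDifferentiableWithinAt 𝓘(ℝ) (𝓡 n) γ I t) (ht : γ t ∈ φ.source) :
    DifferentiableWithinAt ℝ (fun t => φ (γ t)) I t := by
  rw [← mdifferentiableWithinAt_iff_differentiableWithinAt]
  exact ((mdifferentiable_of_mem_maximalAtlas hφ).mdifferentiableAt ht).comp_mdifferentiableWithinAt
    t hγ

theorem differentiableWithinAt_vecIn_change (hφ : φ ∈ IsManifold.maximalAtlas (𝓡 n) ∞ M)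
    (hψ : ψ ∈ IsManifold.maximalAtlas (𝓡 n) ∞ M) (hI : t ∈ I)
    (hγ : MDifferentiableWithinAt 𝓘(ℝ) (𝓡 n) γ I t) (ht : γ t ∈ φ.source) (ht' : γ t ∈ ψ.source)
    (hV : DifferentiableWithinAt ℝ (fun t => vecIn φ (γ t) (V t)) I t) :
    DifferentiableWithinAt ℝ (fun t => vecIn ψ (γ t) (V t)) I t := by
  refine DifferentiableWithinAt.congr_of_eventuallyEq_of_mem ?_
    (eventually_vecIn_change hφ hψ hγ.continuousWithinAt ht ht') hI
  have h1 : DifferentiableAt ℝ (fderiv ℝ (ψ ∘ φ.symm)) (φ (γ t)) :=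
    (((contDiffOn_trans hφ hψ).contDiffAt ((φ.symm ≫ₕ ψ).open_source.mem_nhds
      (mem_trans_source ht ht'))).fderiv_right (m := 1) (by norm_cast)).differentiableAt (by simp)
  exact (DifferentiableAt.comp_differentiableWithinAt (g := fderiv ℝ (ψ ∘ φ.symm)) t h1
    (differentiableWithinAt_chart_comp hφ hγ ht)).clm_apply hV

theorem twiceDiffNear_chart (hφ : φ ∈ IsManifold.maximalAtlas (𝓡 n) ∞ M) (hI : UniqueDiffOn ℝ I)
    (hγ : ContMDiffOn 𝓘(ℝ) (𝓡 n) ∞ γ I) (hs : s ∈ I) (hsφ : γ s ∈ φ.source) :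
    TwiceDiffNear φ.target I (fun t => φ (γ t)) s := by
  filter_upwards [eventually_mem_source (hγ s hs).continuousWithinAt hsφ, self_mem_nhdsWithin]
    with t ht htI
  have h1 : ContDiffWithinAt ℝ ∞ (fun t => φ (γ t)) I t := by
    rw [← contMDiffWithinAt_iff_contDiffWithinAt]
    exact ((contMDiffOn_of_mem_maximalAtlas hφ).contMDiffAt
      (φ.open_source.mem_nhds ht)).comp_contMDiffWithinAt t (hγ t htI)
  have h2 : ContDiffWithinAt ℝ ∞ (derivWithin (fun t => φ (γ t)) I) I t :=
    (h1.fderivWithin_right hI (by norm_cast) htI).clm_apply contDiffWithinAt_const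
  exact ⟨φ.map_source ht, h1.differentiableWithinAt (by simp), h2.differentiableWithinAt (by simp)⟩

variable [IsManifold (𝓡 n) ∞ M] {g : Metric n M}

/-- A vector field along a curve is differentiable if and only if its coordinates in one arbitrary
chart are. -/
theorem diffAlongAt_iff (hφ : φ ∈ IsManifold.maximalAtlas (𝓡 n) ∞ M) (hI : t ∈ I)
    (hγ : MDifferentiableWithinAt 𝓘(ℝ) (𝓡 n) γ I t) (ht : γ t ∈ φ.source) :
    DiffAlongAt γ I V t ↔ DifferentiableWithinAt ℝ (fun t => vecIn φ (γ t) (V t)) I t := by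
  have hψ : chartAt (Coord n) (γ t) ∈ IsManifold.maximalAtlas (𝓡 n) ∞ M :=
    IsManifold.chart_mem_maximalAtlas _
  have hts := mem_chart_source (Coord n) (γ t)
  have h1 : DiffAlongAt γ I V t ↔ DifferentiableWithinAt ℝ
      (fun r => vecIn (chartAt (Coord n) (γ t)) (γ r) (V r)) I t := by
    have h2 : (fun r => (trivializationAt (Coord n) (TangentSpace (𝓡 n)) (γ t) ⟨γ r, V r⟩).2)
        =ᶠ[𝓝[I] t] fun r => vecIn (chartAt (Coord n) (γ t)) (γ r) (V r) := by
      filter_upwards [eventually_mem_source hγ.continuousWithinAt hts] with r hr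
      exact trivializationAt_snd _ hr _
    rw [← h2.differentiableWithinAt_iff_of_mem hI,
      ← mdifferentiableWithinAt_iff_differentiableWithinAt]
    exact (mdifferentiableWithinAt_totalSpace (𝓡 n) _).trans (and_iff_right hγ)
  rw [h1]
  exact ⟨differentiableWithinAt_vecIn_change hψ hφ hI hγ hts ht,
    differentiableWithinAt_vecIn_change hφ hψ hI hγ ht hts⟩

/-- The covariant derivative along a curve in an arbitrary chart. -/
theorem vecIn_covDeriv (hφ : φ ∈ IsManifold.maximalAtlas (𝓡 n) ∞ M) (hI : UniqueDiffOn ℝ I)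
    (htI : t ∈ I) (hγ : MDifferentiableWithinAt 𝓘(ℝ) (𝓡 n) γ I t) (ht : γ t ∈ φ.source)
    (hV : DiffAlongAt γ I V t) :
    vecIn φ (γ t) (covDeriv g γ I V t) = formCovDeriv (connectionForm (metricIn g φ)) I
      (fun t => φ (γ t)) (fun t => vecIn φ (γ t) (V t)) t := by
  set ψ := chartAt (Coord n) (γ t) with hψdef
  have hψ : ψ ∈ IsManifold.maximalAtlas (𝓡 n) ∞ M := IsManifold.chart_mem_maximalAtlas _
  have hts : γ t ∈ ψ.source := mem_chart_source (Coord n) (γ t)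
  have h1 : vecIn ψ (γ t) (covDeriv g γ I V t) = formCovDeriv (connectionForm (metricIn g ψ)) I
      (fun t => ψ (γ t)) (fun t => vecIn ψ (γ t) (V t)) t := by
    rw [formCovDeriv, ← vecIn_velocity hψ (hI t htI) hγ hts, connectionForm_apply]
    exact vecIn_ofCoord (γ t) _
  rw [← vecIn_change hψ hφ hts ht, h1, ← (isIsometryOn_trans hψ hφ).formCovDeriv
    (isMetricOn hψ).isLeviCivitaOn (isMetricOn hφ).isLeviCivitaOn trans_source_subset mapsTo_trans
    (hI t htI) (mem_trans_source hts ht) (differentiableWithinAt_chart_comp hψ hγ hts)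
    ((diffAlongAt_iff hψ htI hγ hts).1 hV)]
  refine formCovDeriv_congr ?_ (eventually_vecIn_change hψ hφ hγ.continuousWithinAt hts ht).symm htI
  filter_upwards [eventually_mem_source hγ.continuousWithinAt hts] with r hr
  simp [hr]

theorem normAt_eq (hφ : φ ∈ IsManifold.maximalAtlas (𝓡 n) ∞ M) {q : M} (hq : q ∈ φ.source)
    (v : TangentSpace (𝓡 n) q) :
    normAt g q v = √(metricForm (metricIn g φ) (φ q) (vecIn φ q v) (vecIn φ q v)) := by
  rw [normAt, inner_eq_metricForm hφ hq]

theorem vecIn_tension (hφ : φ ∈ IsManifold.maximalAtlas (𝓡 n) ∞ M) (hI : UniqueDiffOn ℝ I)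
    (hγ : ContMDiffOn 𝓘(ℝ) (𝓡 n) ∞ γ I) (ht : t ∈ I) (htφ : γ t ∈ φ.source) :
    vecIn φ (γ t) (tension g γ I t) = coordTension (metricIn g φ) I (fun t => φ (γ t)) t := by
  have hm : ∀ r ∈ I, MDifferentiableWithinAt 𝓘(ℝ) (𝓡 n) γ I r :=
    hγ.mdifferentiableOn (by simp)
  have hvel : (fun t => vecIn φ (γ t) (velocity γ I t)) =ᶠ[𝓝[I] t]
      derivWithin (fun t => φ (γ t)) I := by
    filter_upwards [eventually_mem_source (hγ t ht).continuousWithinAt htφ, self_mem_nhdsWithin]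
      with r hr hrI using vecIn_velocity hφ (hI r hrI) (hm r hrI) hr
  have hdiff : DiffAlongAt (n := n) γ I (velocity γ I) t := by
    rw [diffAlongAt_iff hφ ht (hm t ht) htφ, hvel.differentiableWithinAt_iff_of_mem ht]
    exact ((twiceDiffNear_chart hφ hI hγ ht htφ).self_of_nhdsWithin ht).2.2
  rw [tension, vecIn_covDeriv hφ hI ht (hm t ht) htφ hdiff, coordTension]
  exact formCovDeriv_congr .rfl hvel ht

theorem vecIn_pTension (hφ : φ ∈ IsManifold.maximalAtlas (𝓡 n) ∞ M) (hI : UniqueDiffOn ℝ I)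
    (hγ : ContMDiffOn 𝓘(ℝ) (𝓡 n) ∞ γ I) (ht : t ∈ I) (htφ : γ t ∈ φ.source) (p : ℝ) :
    vecIn φ (γ t) (pTension g p γ I t)
      = coordPTension (metricIn g φ) p I (fun t => φ (γ t)) t := by
  rw [pTension, vecIn_smul, normAt_eq hφ htφ, vecIn_tension hφ hI hγ ht htφ]
  rfl

/-- The equation for `p`-biharmonic curves in an arbitrary chart. -/
theorem pBiharmonicAt_iff (hφ : φ ∈ IsManifold.maximalAtlas (𝓡 n) ∞ M) (hI : UniqueDiffOn ℝ I)
    (hγ : ContMDiffOn 𝓘(ℝ) (𝓡 n) ∞ γ I) (hs : s ∈ I) (hsφ : γ s ∈ φ.source) (p : ℝ) :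
    PBiharmonicAt g p γ I s ↔
      CoordPBiharmonicAt (metricIn g φ) p I (fun t => φ (γ t)) s := by
  have hm : ∀ r ∈ I, MDifferentiableWithinAt 𝓘(ℝ) (𝓡 n) γ I r :=
    hγ.mdifferentiableOn (by simp)
  have hsrc := eventually_mem_source (hγ s hs).continuousWithinAt hsφ
  set c : ℝ → Coord n := fun t => φ (γ t) with hc
  set W := coordPTension (metricIn g φ) p I c with hW
  have hpt : ∀ᶠ t in 𝓝[I] s, vecIn φ (γ t) (pTension g p γ I t) = W t := by
    filter_upwards [hsrc, self_mem_nhdsWithin] with t ht htI using vecIn_pTension hφ hI hγ htI ht p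
  have hpt' : ∀ᶠ t in 𝓝[I] s, (fun t => vecIn φ (γ t) (pTension g p γ I t)) =ᶠ[𝓝[I] t] W :=
    eventually_eventually_nhdsWithin.2 hpt
  have hdiff : (∀ᶠ t in 𝓝[I] s, DiffAlongAt γ I (pTension g p γ I) t) ↔
      ∀ᶠ t in 𝓝[I] s, DifferentiableWithinAt ℝ W I t := by
    refine Filter.eventually_congr ?_
    filter_upwards [hsrc, hpt', self_mem_nhdsWithin] with t ht htW htI
    rw [diffAlongAt_iff hφ htI (hm t htI) ht, htW.differentiableWithinAt_iff_of_mem htI]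
  have hcov : (∀ᶠ t in 𝓝[I] s, DiffAlongAt γ I (pTension g p γ I) t) →
      (fun t => vecIn φ (γ t) (covDeriv g γ I (pTension g p γ I) t)) =ᶠ[𝓝[I] s]
        formCovDeriv (connectionForm (metricIn g φ)) I c W := fun h => by
    filter_upwards [hsrc, hpt', self_mem_nhdsWithin, h] with t ht htW htI htd
    rw [vecIn_covDeriv hφ hI htI (hm t htI) ht htd]
    exact formCovDeriv_congr .rfl htW htI
  have hdiff2 : (∀ᶠ t in 𝓝[I] s, DiffAlongAt γ I (pTension g p γ I) t) →
      (DiffAlongAt γ I (covDeriv g γ I (pTension g p γ I)) s ↔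
        DifferentiableWithinAt ℝ (formCovDeriv (connectionForm (metricIn g φ)) I c W) I s) :=
    fun h => by
      rw [diffAlongAt_iff hφ hs (hm s hs) hsφ, (hcov h).differentiableWithinAt_iff_of_mem hs]
  have heq : (∀ᶠ t in 𝓝[I] s, DiffAlongAt γ I (pTension g p γ I) t) →
      DiffAlongAt γ I (covDeriv g γ I (pTension g p γ I)) s →
      vecIn φ (γ s) (covDeriv g γ I (covDeriv g γ I (pTension g p γ I)) s
        - normAt g (γ s) (tension g γ I s) ^ (p - 2) •
          curvature g (γ s) (velocity γ I s) (tension g γ I s) (velocity γ I s))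
      = formCovDeriv (connectionForm (metricIn g φ)) I c
          (formCovDeriv (connectionForm (metricIn g φ)) I c W) s
        - √(metricForm (metricIn g φ) (c s) (coordTension (metricIn g φ) I c s)
            (coordTension (metricIn g φ) I c s)) ^ (p - 2) •
          curvatureVec (metricIn g φ) (c s) (derivWithin c I s)
            (coordTension (metricIn g φ) I c s) (derivWithin c I s) := fun h h' => by
    rw [vecIn_sub, vecIn_smul, vecIn_covDeriv hφ hI hs (hm s hs) hsφ h', vecIn_curvature hφ hsφ,
      normAt_eq hφ hsφ, vecIn_tension hφ hI hγ hs hsφ, vecIn_velocity hφ (hI s hs) (hm s hs) hsφ,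
      formCovDeriv_congr .rfl (hcov h) hs]
  constructor
  · rintro ⟨h1, h2, h3⟩
    refine ⟨hdiff.1 h1, (hdiff2 h1).1 h2, ?_⟩
    rw [← heq h1 h2, h3]
    exact (vecIn_eq_zero_iff hφ hsφ 0).2 rfl
  · rintro ⟨h1, h2, h3⟩
    have h1' := hdiff.2 h1
    have h2' := (hdiff2 h1').2 h2
    exact ⟨h1', h2', (vecIn_eq_zero_iff hφ hsφ _).1 ((heq h1' h2').trans h3)⟩

/-- In a single chart, the equation for `p`-biharmonic curves is equivalent to the system of
Euler-Lagrange equations. -/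
theorem pBiharmonicAt_iff_eulerLagrangeAt (hφ : φ ∈ IsManifold.maximalAtlas (𝓡 n) ∞ M)
    (hI : UniqueDiffOn ℝ I) (hγ : ContMDiffOn 𝓘(ℝ) (𝓡 n) ∞ γ I) (hs : s ∈ I)
    (hsφ : γ s ∈ φ.source) {p : ℝ} (hp : 0 < p) (hτ : p < 2 → ∀ s ∈ I, tension g γ I s ≠ 0) :
    PBiharmonicAt g p γ I s ↔
      ∀ k, EulerLagrangeAt (metricIn g φ) p I (fun t => φ (γ t)) k s := by
  rw [pBiharmonicAt_iff hφ hI hγ hs hsφ]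
  refine (isMetricOn hφ).coordPBiharmonicAt_iff hp.ne' hI hs
    (twiceDiffNear_chart hφ hI hγ hs hsφ) ?_
  filter_upwards [eventually_mem_source (hγ s hs).continuousWithinAt hsφ, self_mem_nhdsWithin]
    with t ht htI
  refine (lt_or_ge p 2).imp (fun hp2 => ?_) id
  rw [← vecIn_tension hφ hI hγ htI ht, Ne, vecIn_eq_zero_iff hφ ht]
  exact hτ hp2 t htI

end Curves

end PBiharmonic

end

theorem mainTheorem10 {n : ℕ} {M : Type*} [TopologicalSpace M]
    [ChartedSpace (PBiharmonic.Coord n) M] [IsManifold (𝓡 n) ∞ M]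
    (g : PBiharmonic.Metric n M) (p : ℝ) (hp : 0 < p)
    (I : Set ℝ) (hI : I.OrdConnected) (hI' : I.Nontrivial)
    (γ : ℝ → M) (hγ : ContMDiffOn 𝓘(ℝ) (𝓡 n) ∞ γ I)
    (hτ : p < 2 → ∀ s ∈ I, PBiharmonic.tension g γ I s ≠ 0) :
    ((∀ s ∈ I, PBiharmonic.PBiharmonicAt g p γ I s) ↔
      ∀ φ ∈ IsManifold.maximalAtlas (𝓡 n) ∞ M, ∀ s ∈ I, γ s ∈ φ.source →
        ∀ k : Fin n, PBiharmonic.EulerLagrangeAt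
          (PBiharmonic.metricIn g φ) p I (fun t => φ (γ t)) k s) ∧
    (∀ φ ∈ IsManifold.maximalAtlas (𝓡 n) ∞ M, ∀ s ∈ I, γ s ∈ φ.source →
      (PBiharmonic.PBiharmonicAt g p γ I s ↔
        ∀ k : Fin n, PBiharmonic.EulerLagrangeAt
          (PBiharmonic.metricIn g φ) p I (fun t => φ (γ t)) k s)) := by
  have hU : UniqueDiffOn ℝ I := by
    obtain ⟨a, ha, b, hb, hab⟩ := hI'.exists_lt
    refine uniqueDiffOn_convex hI.convex ⟨(a + b) / 2, ?_⟩
    exact interior_mono (hI.out ha hb) (by rw [interior_Icc]; constructor <;> linarith)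
  have key : ∀ φ ∈ IsManifold.maximalAtlas (𝓡 n) ∞ M, ∀ s ∈ I, γ s ∈ φ.source →
      (PBiharmonic.PBiharmonicAt g p γ I s ↔
        ∀ k : Fin n, PBiharmonic.EulerLagrangeAt
          (PBiharmonic.metricIn g φ) p I (fun t => φ (γ t)) k s) := fun φ hφ s hs hsφ =>
    PBiharmonic.pBiharmonicAt_iff_eulerLagrangeAt hφ hU hγ hs hsφ hp hτ
  refine ⟨⟨fun h φ hφ s hs hsφ => (key φ hφ s hs hsφ).1 (h s hs), fun h s hs => ?_⟩, key⟩
  have hφ : chartAt (PBiharmonic.Coord n) (γ s) ∈ IsManifold.maximalAtlas (𝓡 n) ∞ M :=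
    IsManifold.chart_mem_maximalAtlas _
  exact (key _ hφ s hs (mem_chart_source _ _)).2 (h _ hφ s hs (mem_chart_source _ _))
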